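/- Let $I$ be a finite set with at least two elements and let $t_i:\mathbb{R}^n\to[0,\infty)$, $i\in I$, be log-concave, i.e. $t_i(\lambda x+(1-\lambda)y)\ge t_i(x)^{\lambda}t_i(y)^{1-\lambda}$ for all $x,y\in\mathbb{R}^n$ and $\lambda\in[0,1]$. Suppose that the $t_i$ are uniformly bounded and that the support of each $t_i$ has positive Lebesgue measure. Write $N(\cdot\,;\mu,C)$ for the Gaussian density with mean $\mu$ and positive definite covariance $C$. At iteration $k$ of expectation propagation (EP) for $\prod_i t_i$, let the factor approximations $\tilde t_j$, $j\in I$, be Gaussian with positive definite covariances $C_j$, that is, $\tilde t_j=s_jN(\cdot\,;\mu_j,C_j)$ with $s_j>0$. For $i\in I$ the EP update at step $k+1$ of the $i$-th factor approximation replaces $\tilde t_i$ by $\tilde q/\prod_{j\ne i}\tilde t_j$, where $\tilde q$ minimizes the Kullback-Leibler divergence $D_{KL}(q,\tilde q)$ over all Gaussian densities with positive definite covariance, and $q=Z^{-1}t_i\prod_{j\neq i}\tilde t_j$ with $Z=\int t_i\prod_{j\ne i}\tilde t_j\,dx$. Then, for every $i\in I$, this update is well defined and has a positive semidefinite precision.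 Precisely: the cavity function $\prod_{j\ne i}\tilde t_j$ is a positive multiple of a Gaussian density $N(\cdot\,;\mu_{\setminus i},C_{\setminus i})$ with $C_{\setminus i}$ positive definite; $q$ is a probability density with finite second moments; the minimizer $\tilde q=N(\cdot\,;\mu,C)$ exists and is unique, and $\mu$ and $C$ are the mean and the covariance of $q$; and $$C^{-1}-C_{\setminus i}^{-1}\succeq 0,$$ where $C^{-1}-C_{\setminus i}^{-1}$ is the precision of the updated factor, i.e. $\tilde q(x)/\prod_{j\ne i}\tilde t_j(x)=s\exp\bigl(h^{\mathsf T}x-\tfrac12x^{\mathsf T}(C^{-1}-C_{\setminus i}^{-1})x\bigr)$ for some $s>0$ and $h\in\mathbb{R}^n$. -/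

import Mathlib

open scoped Matrix

namespace EP

/-- A function `f` on a real vector space is log-concave: it is nonnegative and
`f (lam x + (1 - lam) y) ≥ f x ^ lam * f y ^ (1 - lam)` for all points and all `lam` in `[0, 1]`.
(In Lean `0 ^ 0 = 1`, so that the inequality is trivial for `lam = 0` and `lam = 1`.) -/
def LogConcave {V : Type*} [AddCommGroup V] [Module ℝ V] (f : V → ℝ) : Prop :=
  (∀ x, 0 ≤ f x) ∧
    ∀ x y : V, ∀ lam : ℝ, 0 ≤ lam → lam ≤ 1 →
      f x ^ lam * f y ^ (1 - lam) ≤ f (lam • x + (1 - lam) • y)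

/-- The density `N(x; m, C)` on `ℝⁿ` of the Gaussian with mean `m` and covariance `C`
(for positive definite `C`). -/
noncomputable def gaussianDensity {n : ℕ} (m : Fin n → ℝ) (C : Matrix (Fin n) (Fin n) ℝ)
    (x : Fin n → ℝ) : ℝ :=
  (Real.sqrt ((2 * Real.pi) ^ n * C.det))⁻¹ *
    Real.exp (-(1 / 2) * ((x - m) ⬝ᵥ (C⁻¹ *ᵥ (x - m))))

/-- The Gaussian law with mean `m` and covariance `C` (for positive definite `C`). -/
noncomputable def gaussianLaw {n : ℕ} (m : Fin n → ℝ) (C : Matrix (Fin n) (Fin n) ℝ) :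
    MeasureTheory.Measure (Fin n → ℝ) :=
  MeasureTheory.volume.withDensity (fun x => ENNReal.ofReal (gaussianDensity m C x))

/-- `f` is a Gaussian factor with mean `m` and positive definite covariance `C`: a positive
constant multiple of `N(· ; m, C)`. -/
def IsGaussianFactor {n : ℕ} (f : (Fin n → ℝ) → ℝ) (m : Fin n → ℝ)
    (C : Matrix (Fin n) (Fin n) ℝ) : Prop :=
  C.PosDef ∧ ∃ s : ℝ, 0 < s ∧ ∀ x, f x = s * gaussianDensity m C x

/-- The cavity function `∏_{j ≠ i} tt_j` of the factor approximations `tt`. -/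
noncomputable def cavity {n : ℕ} {I : Type*} [Fintype I] [DecidableEq I]
    (tt : I → (Fin n → ℝ) → ℝ) (i : I) (x : Fin n → ℝ) : ℝ :=
  ∏ j ∈ Finset.univ.erase i, tt j x

/-- The tilted distribution: the law with density proportional to `t_i ∏_{j ≠ i} tt_j`. -/
noncomputable def tilted {n : ℕ} {I : Type*} [Fintype I] [DecidableEq I]
    (t tt : I → (Fin n → ℝ) → ℝ) (i : I) : MeasureTheory.Measure (Fin n → ℝ) :=
  MeasureTheory.volume.withDensity (fun x =>
    ENNReal.ofReal (t i x * cavity tt i x / ∫ y, t i y * cavity tt i y))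

/-- `N(m, C)` minimizes the Kullback-Leibler divergence `D_KL(Q, ·)` over all Gaussians with
positive definite covariance. -/
def IsGaussianKLMinimizer {n : ℕ} (Q : MeasureTheory.Measure (Fin n → ℝ)) (m : Fin n → ℝ)
    (C : Matrix (Fin n) (Fin n) ℝ) : Prop :=
  C.PosDef ∧ ∀ (m' : Fin n → ℝ) (C' : Matrix (Fin n) (Fin n) ℝ), C'.PosDef →
    InformationTheory.klDiv Q (gaussianLaw m C) ≤ InformationTheory.klDiv Q (gaussianLaw m' C')

/-- The updated `i`-th factor approximation `N(x; m, C) / ∏_{j ≠ i} tt_j(x)`, where `N(m, C)` is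
the Gaussian approximation of the tilted distribution. -/
noncomputable def updatedFactor {n : ℕ} {I : Type*} [Fintype I] [DecidableEq I]
    (tt : I → (Fin n → ℝ) → ℝ) (i : I) (m : Fin n → ℝ) (C : Matrix (Fin n) (Fin n) ℝ)
    (x : Fin n → ℝ) : ℝ :=
  gaussianDensity m C x / cavity tt i x

end EP

/-!
Collecting exponents, the cavity function is a multiple of `exp (h ⬝ x - xᵀ P x / 2)` with `P` the
(positive definite) sum of the precisions of its factors, so the tilted law `Q` is a log-concave
function `t` times a Gaussian with covariance `P⁻¹`, normalized (`logConcaveLaw`).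

*Existence and uniqueness of the minimizer.* The law `Q` has all exponential moments, and
`t * log t` is bounded, so the entropy of `Q` and its divergence from every Gaussian `N(m, C)` are
finite. The divergence is
`const + (log det C + tr (C⁻¹ S) + (μ - m)ᵀ C⁻¹ (μ - m)) / 2`
with `μ`, `S` the mean and covariance of `Q` (`klDiv_gaussianLaw_eq`). The eigenvalue inequality
`log λ ≤ λ - 1` shows that `m = μ`, `C = S` is its only minimum.

*Semidefiniteness.* It suffices that `vᵀ S v ≤ vᵀ P⁻¹ v` for all `v` and then to invert
(`posSemidef_inv_sub_inv`). With `φ v = ∫ t x * exp ((h + v) ⬝ x - xᵀ P x / 2) dx`, the function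
`v ↦ φ v * exp (- (h + v)ᵀ P⁻¹ (h + v) / 2)` is, up to a linear change of variables, the
convolution of `t` with a Gaussian, hence log-concave, and the
Prékopa–Leindler inequality gives `φ v * φ (-v) ≤ exp (vᵀ P⁻¹ v) * φ 0 ^ 2`
(`integral_mul_gaussianExp_mul_le`). The left-hand side divided by `φ 0 ^ 2` is the product of the
means of `exp (v ⬝ x)` and `exp (- v ⬝ x)` under `Q`, which is at least `1 + Var (v ⬝ x)`
(`one_add_variance_le_integral_exp_mul`). Replacing `v` by `r v` and letting `r → 0` gives the
bound on the variance.

The Prékopa–Leindler inequality is proved for Borel functions with values in `[0, ∞]`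
(`lintegral_mul_lintegral_le_sq`). A log-concave function need not be Borel, but it agrees almost
everywhere with its lower semicontinuous regularization, which inherits the midpoint inequality.
-/

open MeasureTheory Set Filter Topology ProbabilityTheory InformationTheory
open scoped ENNReal Pointwise

namespace EP

/-! ### The Prékopa–Leindler inequality for midpoints -/

theorem volume_add_le_of_isCompact {K L : Set ℝ} (hK : IsCompact K) (hL : IsCompact L)
    (hK0 : K.Nonempty) (hL0 : L.Nonempty) : volume K + volume L ≤ volume (K + L) := by
  -- The translates `K + min L` and `max K + L` lie in `K + L` and meet in one point only.
  set a := sSup K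
  set b := sInf L
  have ha : a ∈ K := hK.sSup_mem hK0
  have hb : b ∈ L := hL.sInf_mem hL0
  have hinter : volume ((b +ᵥ K) ∩ (a +ᵥ L)) = 0 := by
    refine measure_mono_null (t := {a + b}) ?_ (by simp)
    rintro x ⟨⟨k, hk, rfl⟩, ⟨l, hl, hkl⟩⟩
    have h1 : k ≤ a := le_csSup hK.bddAbove hk
    have h2 : b ≤ l := csInf_le hL.bddBelow hl
    simp only [vadd_eq_add] at hkl
    simp only [vadd_eq_add, mem_singleton_iff]
    linarith
  calc volume K + volume L = volume (b +ᵥ K) + volume (a +ᵥ L) := by simp [measure_vadd]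
    _ = volume ((b +ᵥ K) ∪ (a +ᵥ L)) := by
      rw [← measure_union_add_inter _ (hL.vadd a).measurableSet, hinter, add_zero]
    _ ≤ volume (K + L) := by
      refine measure_mono (union_subset ?_ ?_)
      · rintro _ ⟨k, hk, rfl⟩
        exact ⟨k, hk, b, hb, add_comm _ _⟩
      · rintro _ ⟨l, hl, rfl⟩
        exact ⟨a, ha, l, hl, rfl⟩

/-- The Brunn–Minkowski inequality on the line. -/
theorem volume_add_le {A B : Set ℝ} (hA : MeasurableSet A) (hB : MeasurableSet B)
    (hA0 : A.Nonempty) (hB0 : B.Nonempty) : volume A + volume B ≤ volume (A + B) := by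
  obtain ⟨a, ha⟩ := hA0
  obtain ⟨b, hb⟩ := hB0
  rw [hA.measure_eq_iSup_isCompact, hB.measure_eq_iSup_isCompact]
  simp only [iSup_and']
  refine ENNReal.biSup_add_biSup_le' ⟨∅, empty_subset _, isCompact_empty⟩
    ⟨∅, empty_subset _, isCompact_empty⟩ fun K hK L hL => ?_
  -- Adding a point makes the compact sets nonempty.
  calc volume K + volume L ≤ volume (insert a K) + volume (insert b L) := by
        gcongr <;> exact subset_insert _ _
    _ ≤ volume (insert a K + insert b L) :=
        volume_add_le_of_isCompact (hK.2.insert a) (hL.2.insert b) ⟨a, mem_insert _ _⟩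
          ⟨b, mem_insert _ _⟩
    _ ≤ volume (A + B) := measure_mono
        (add_subset_add (insert_subset ha hK.1) (insert_subset hb hL.1))

theorem volume_add_le_two_mul_of_midpoint {A B D : Set ℝ} (hA : MeasurableSet A)
    (hB : MeasurableSet B) (hA0 : A.Nonempty) (hB0 : B.Nonempty)
    (h : ∀ a ∈ A, ∀ b ∈ B, (2⁻¹ : ℝ) • (a + b) ∈ D) :
    volume A + volume B ≤ 2 * volume D := by
  calc volume A + volume B ≤ volume (A + B) := volume_add_le hA hB hA0 hB0
    _ ≤ volume ((2 : ℝ) • D) := by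
      refine measure_mono ?_
      rintro _ ⟨a, ha, b, hb, rfl⟩
      exact ⟨_, h a ha b hb, by simp⟩
    _ = 2 * volume D := by simp [Measure.addHaar_smul]

theorem lintegral_eq_lintegral_Ioo_meas_lt {f : ℝ → ℝ≥0∞} (hf : Measurable f)
    (h1 : ∀ x, f x ≤ 1) :
    ∫⁻ x, f x = ∫⁻ s in Ioo (0 : ℝ) 1, volume {x | ENNReal.ofReal s < f x} := by
  have hfin : ∀ x, f x ≠ ∞ := fun x => ((h1 x).trans_lt ENNReal.one_lt_top).ne
  have h := lintegral_eq_lintegral_meas_lt (volume : Measure ℝ) (f := fun x => (f x).toReal)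
    (Eventually.of_forall fun x => ENNReal.toReal_nonneg) hf.ennreal_toReal.aemeasurable
  simp only [ENNReal.ofReal_toReal (hfin _)] at h
  rw [h, ← Ioo_union_Ici_eq_Ioi (zero_lt_one' ℝ), lintegral_union measurableSet_Ici]
  · have h0 : ∫⁻ s in Ici (1 : ℝ), volume {x | s < (f x).toReal} = 0 := by
      rw [setLIntegral_congr_fun (g := fun _ => 0) measurableSet_Ici]
      · simp
      · intro s hs
        have : {x | s < (f x).toReal} = ∅ := by
          ext x
          simp only [mem_ofPred_eq, mem_empty_iff_false, iff_false, not_lt]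
          exact (ENNReal.toReal_mono ENNReal.one_ne_top (h1 x)).trans (by simpa using hs)
        simp [this]
    rw [h0, add_zero]
    refine setLIntegral_congr_fun measurableSet_Ioo fun s hs => ?_
    congr 1
    ext x
    exact (ENNReal.ofReal_lt_iff_lt_toReal hs.1.le (hfin x)).symm
  · exact Set.disjoint_left.2 fun x hx hx' => not_lt.2 hx' hx.2

/-- For functions with supremum `1`, even the arithmetic mean of the integrals is bounded:
the superlevel sets satisfy the Brunn–Minkowski inequality. -/
theorem lintegral_add_le_two_mul_of_midpoint {f g h : ℝ → ℝ≥0∞} (hf : Measurable f)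
    (hg : Measurable g) (hh : Measurable h) (hf1 : ⨆ x, f x = 1) (hg1 : ⨆ x, g x = 1)
    (H : ∀ x y, f x * g y ≤ h ((2⁻¹ : ℝ) • (x + y)) ^ 2) :
    (∫⁻ x, f x) + ∫⁻ x, g x ≤ 2 * ∫⁻ x, h x := by
  have hfle : ∀ x, f x ≤ 1 := fun x => hf1 ▸ le_iSup f x
  have hgle : ∀ x, g x ≤ 1 := fun x => hg1 ▸ le_iSup g x
  have hmeas : ∀ F : ℝ → ℝ≥0∞, Antitone fun s : ℝ => volume {x | ENNReal.ofReal s < F x} :=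
    fun F s s' hss => measure_mono fun x (hx : _ < _) =>
      (ENNReal.ofReal_le_ofReal hss).trans_lt hx
  calc (∫⁻ x, f x) + ∫⁻ x, g x
      = ∫⁻ s in Ioo (0 : ℝ) 1, (volume {x | ENNReal.ofReal s < f x}
          + volume {x | ENNReal.ofReal s < g x}) := by
        rw [lintegral_eq_lintegral_Ioo_meas_lt hf hfle, lintegral_eq_lintegral_Ioo_meas_lt hg hgle,
          lintegral_add_left (hmeas f).measurable]
    _ ≤ ∫⁻ s in Ioo (0 : ℝ) 1, 2 * volume {x | ENNReal.ofReal s < min (h x) 1} := by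
        refine setLIntegral_mono' measurableSet_Ioo fun s hs => ?_
        have hs1 : ENNReal.ofReal s < 1 := by simpa using hs.2
        refine volume_add_le_two_mul_of_midpoint (measurableSet_lt measurable_const hf)
          (measurableSet_lt measurable_const hg) (lt_iSup_iff.1 (hs1.trans_eq hf1.symm))
          (lt_iSup_iff.1 (hs1.trans_eq hg1.symm)) fun a ha b hb => lt_min ?_ hs1
        have hab : ENNReal.ofReal s ^ 2 < h ((2⁻¹ : ℝ) • (a + b)) ^ 2 :=
          (sq (ENNReal.ofReal s) ▸ ENNReal.mul_lt_mul ha hb).trans_le (H a b)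
        exact lt_of_not_ge fun hle => not_lt.2 (pow_le_pow_left' hle 2) hab
    _ = 2 * ∫⁻ x, min (h x) 1 := by
        rw [lintegral_const_mul _ (hmeas _).measurable,
          lintegral_eq_lintegral_Ioo_meas_lt (hh.min measurable_const) fun x => min_le_right _ _]
    _ ≤ 2 * ∫⁻ x, h x := by gcongr; exact min_le_left _ _

theorem four_mul_mul_le_sq_add_ennreal (a b : ℝ≥0∞) : 4 * a * b ≤ (a + b) ^ 2 := by
  rcases eq_or_ne a ∞ with rfl | ha
  · simp
  rcases eq_or_ne b ∞ with rfl | hb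
  · simp
  lift a to NNReal using ha
  lift b to NNReal using hb
  exact_mod_cast _root_.four_mul_le_sq_add a b

/-- The bounded case on the line, by scaling both suprema to `1`. -/
theorem lintegral_mul_lintegral_le_sq_real_of_bounded {f g h : ℝ → ℝ≥0∞} (hf : Measurable f)
    (hg : Measurable g) (hh : Measurable h) (hfb : ⨆ x, f x ≠ ∞) (hgb : ⨆ x, g x ≠ ∞)
    (H : ∀ x y, f x * g y ≤ h ((2⁻¹ : ℝ) • (x + y)) ^ 2) :
    (∫⁻ x, f x) * ∫⁻ x, g x ≤ (∫⁻ x, h x) ^ 2 := by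
  set a := ⨆ x, f x with ha
  set b := ⨆ x, g x with hb
  rcases eq_or_ne a 0 with ha0 | ha0
  · have : ∀ x, f x = 0 := by simpa [ha] using ha0
    simp [this]
  rcases eq_or_ne b 0 with hb0 | hb0
  · have : ∀ x, g x = 0 := by simpa [hb] using hb0
    simp [this]
  obtain ⟨c, hc⟩ : ∃ c : ℝ≥0∞, c ^ 2 = a * b :=
    ⟨(a * b) ^ (2⁻¹ : ℝ), by rw [← ENNReal.rpow_natCast, ← ENNReal.rpow_mul]; norm_num⟩
  have hc0 : c ≠ 0 := by
    rintro rfl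
    exact mul_ne_zero ha0 hb0 (by rw [← hc]; simp)
  have hct : c ≠ ∞ := by
    rintro rfl
    exact ENNReal.mul_ne_top hfb hgb (by rw [← hc]; simp)
  have hcinv : (c⁻¹) ^ 2 = a⁻¹ * b⁻¹ := by
    rw [← ENNReal.inv_pow, hc, ENNReal.mul_inv (Or.inl ha0) (Or.inl hfb)]
  have key := lintegral_add_le_two_mul_of_midpoint (hf.const_mul a⁻¹) (hg.const_mul b⁻¹)
    (hh.const_mul c⁻¹) (by rw [← ENNReal.mul_iSup, ← ha, ENNReal.inv_mul_cancel ha0 hfb])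
    (by rw [← ENNReal.mul_iSup, ← hb, ENNReal.inv_mul_cancel hb0 hgb]) (fun x y => by
      rw [mul_pow, hcinv, mul_mul_mul_comm]
      gcongr
      exact H x y)
  rw [lintegral_const_mul _ hf, lintegral_const_mul _ hg, lintegral_const_mul _ hh] at key
  set F := ∫⁻ x, f x
  set G := ∫⁻ x, g x
  set K := ∫⁻ x, h x
  have h4 : 4 * (a⁻¹ * F) * (b⁻¹ * G) ≤ 4 * ((a⁻¹ * b⁻¹) * K ^ 2) :=
    calc 4 * (a⁻¹ * F) * (b⁻¹ * G) ≤ (a⁻¹ * F + b⁻¹ * G) ^ 2 :=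
          four_mul_mul_le_sq_add_ennreal _ _
      _ ≤ (2 * (c⁻¹ * K)) ^ 2 := by gcongr
      _ = 4 * ((a⁻¹ * b⁻¹) * K ^ 2) := by rw [← hcinv]; ring
  have h5 : (a⁻¹ * b⁻¹) * (F * G) ≤ (a⁻¹ * b⁻¹) * K ^ 2 := by
    rw [← ENNReal.mul_le_mul_iff_right (a := 4) (by norm_num) (by norm_num)]
    calc 4 * ((a⁻¹ * b⁻¹) * (F * G)) = 4 * (a⁻¹ * F) * (b⁻¹ * G) := by ring
      _ ≤ _ := h4
  rwa [ENNReal.mul_le_mul_iff_right (by simp [hfb, hgb]) (by finiteness)] at h5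

theorem lintegral_mul_lintegral_le_sq_real {f g h : ℝ → ℝ≥0∞} (hf : Measurable f)
    (hg : Measurable g) (hh : Measurable h)
    (H : ∀ x y, f x * g y ≤ h ((2⁻¹ : ℝ) • (x + y)) ^ 2) :
    (∫⁻ x, f x) * ∫⁻ x, g x ≤ (∫⁻ x, h x) ^ 2 := by
  have trunc : ∀ F : ℝ → ℝ≥0∞, Measurable F →
      ∫⁻ x, F x = ⨆ N : ℕ, ∫⁻ x, min (F x) N := by
    intro F hF
    rw [← lintegral_iSup (fun N => hF.min measurable_const)
      (fun N M hNM x => min_le_min_left _ (by exact_mod_cast hNM))]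
    congr 1 with x
    rw [← inf_iSup_eq, ENNReal.iSup_natCast, inf_top_eq]
  have bdd : ∀ (F : ℝ → ℝ≥0∞) (N : ℕ), ⨆ x, min (F x) (N : ℝ≥0∞) ≠ ∞ := fun F N =>
    ((iSup_le fun x => min_le_right _ _).trans_lt (ENNReal.natCast_lt_top N)).ne
  rw [trunc f hf, trunc g hg, ENNReal.iSup_mul]
  refine iSup_le fun N => ?_
  rw [ENNReal.mul_iSup]
  refine iSup_le fun M => lintegral_mul_lintegral_le_sq_real_of_bounded
    (hf.min measurable_const) (hg.min measurable_const) hh (bdd f N) (bdd g M) fun x y => ?_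
  exact (mul_le_mul' (min_le_left _ _) (min_le_left _ _)).trans (H x y)

/-- The Prékopa–Leindler inequality on `ℝⁿ` with weights `1/2`, written without square roots.
The induction on the dimension integrates out all coordinates but the first. -/
theorem lintegral_mul_lintegral_le_sq {n : ℕ} {f g h : (Fin n → ℝ) → ℝ≥0∞} (hf : Measurable f)
    (hg : Measurable g) (hh : Measurable h)
    (H : ∀ x y, f x * g y ≤ h ((2⁻¹ : ℝ) • (x + y)) ^ 2) :
    (∫⁻ x, f x) * ∫⁻ x, g x ≤ (∫⁻ x, h x) ^ 2 := by
  induction n with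
  | zero =>
    simp only [lintegral_unique, Measure.volume_pi_eq_dirac (default : Fin 0 → ℝ),
      measure_univ, mul_one]
    have h0 := H default default
    rw [Subsingleton.elim ((2⁻¹ : ℝ) • (default + default : Fin 0 → ℝ)) default] at h0
    convert h0
  | succ n ih =>
    set e := MeasurableEquiv.piFinSuccAbove (fun _ : Fin (n + 1) => ℝ) 0
    have he : MeasurePreserving e.symm (volume.prod volume) volume :=
      (volume_preserving_piFinSuccAbove (fun _ : Fin (n + 1) => ℝ) 0).symm _
    have fub : ∀ F : (Fin (n + 1) → ℝ) → ℝ≥0∞, Measurable F →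
        ∫⁻ x, F x = ∫⁻ a : ℝ, ∫⁻ u : Fin n → ℝ, F (e.symm (a, u)) := by
      intro F hF
      rw [← he.lintegral_comp hF]
      exact lintegral_prod _ (hF.comp e.symm.measurable).aemeasurable
    have hmid : ∀ (a b : ℝ) (u v : Fin n → ℝ), e.symm ((2⁻¹ : ℝ) • (a + b), (2⁻¹ : ℝ) • (u + v))
        = (2⁻¹ : ℝ) • (e.symm (a, u) + e.symm (b, v)) := by
      intro a b u v
      ext k
      refine Fin.cases ?_ (fun k => ?_) k <;> simp [e, MeasurableEquiv.piFinSuccAbove, mul_add]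
    have hs : ∀ F : (Fin (n + 1) → ℝ) → ℝ≥0∞, Measurable F → ∀ a : ℝ,
        Measurable fun u : Fin n → ℝ => F (e.symm (a, u)) := fun F hF a =>
      hF.comp (e.symm.measurable.comp measurable_prodMk_left)
    have hm : ∀ F : (Fin (n + 1) → ℝ) → ℝ≥0∞, Measurable F →
        Measurable fun a : ℝ => ∫⁻ u : Fin n → ℝ, F (e.symm (a, u)) := fun F hF =>
      Measurable.lintegral_prod_right (hF.comp e.symm.measurable)
    rw [fub f hf, fub g hg, fub h hh]
    refine lintegral_mul_lintegral_le_sq_real (hm f hf) (hm g hg) (hm h hh) fun a b => ?_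
    refine ih (hs f hf a) (hs g hg b) (hs h hh _) fun u v => ?_
    rw [hmid]
    exact H _ _

/-! ### Measurability of log-concave functions -/

theorem LogConcave.mul_le_sq_midpoint {V : Type*} [AddCommGroup V] [Module ℝ V] {f : V → ℝ}
    (hf : LogConcave f) (x y : V) : f x * f y ≤ f ((2⁻¹ : ℝ) • (x + y)) ^ 2 := by
  have h := hf.2 x y 2⁻¹ (by norm_num) (by norm_num)
  rw [show (1 - 2⁻¹ : ℝ) = 2⁻¹ by norm_num, ← smul_add,
    ← Real.mul_rpow (hf.1 x) (hf.1 y)] at h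
  have h2 := pow_le_pow_left₀ (Real.rpow_nonneg (mul_nonneg (hf.1 x) (hf.1 y)) _) h 2
  rwa [← Real.rpow_natCast, ← Real.rpow_mul (mul_nonneg (hf.1 x) (hf.1 y)),
    show (2⁻¹ : ℝ) * (2 : ℕ) = 1 by norm_num, Real.rpow_one] at h2

theorem LogConcave.convex_lt {V : Type*} [AddCommGroup V] [Module ℝ V] {f : V → ℝ}
    (hf : LogConcave f) {r : ℝ} (hr : 0 ≤ r) : Convex ℝ {x | r < f x} := by
  intro x hx y hy a b ha hb hab
  obtain rfl : b = 1 - a := by linarith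
  set m := min (f x) (f y)
  have hm : r < m := lt_min hx hy
  have hm0 : 0 < m := hr.trans_lt hm
  calc r < m := hm
    _ = m ^ a * m ^ (1 - a) := by rw [← Real.rpow_add hm0]; simp
    _ ≤ f x ^ a * f y ^ (1 - a) := by
      exact mul_le_mul (Real.rpow_le_rpow hm0.le (min_le_left _ _) ha)
        (Real.rpow_le_rpow hm0.le (min_le_right _ _) hb) (Real.rpow_nonneg hm0.le _)
        (Real.rpow_nonneg (hf.1 x) _)
    _ ≤ f (a • x + (1 - a) • y) := hf.2 x y a ha (by linarith)

/-- The lower semicontinuous regularization of a nonnegative function, with values in `[0, ∞]`. -/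
noncomputable def lscReg {E : Type*} [TopologicalSpace E] (f : E → ℝ) (x : E) : ℝ≥0∞ :=
  liminf (fun y => ENNReal.ofReal (f y)) (𝓝 x)

theorem lt_lscReg_iff {E : Type*} [TopologicalSpace E] {f : E → ℝ} {x : E} {r : ℝ≥0∞} :
    r < lscReg f x ↔ ∃ s, r < s ∧ ∀ᶠ y in 𝓝 x, s < ENNReal.ofReal (f y) := by
  constructor
  · intro h
    obtain ⟨s, hrs, hs⟩ := exists_between h
    exact ⟨s, hrs, eventually_lt_of_lt_liminf hs⟩
  · rintro ⟨s, hrs, hs⟩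
    exact hrs.trans_le (le_liminf_of_le (by isBoundedDefault) (hs.mono fun _ h => h.le))

theorem measurable_lscReg {E : Type*} [TopologicalSpace E] [MeasurableSpace E]
    [OpensMeasurableSpace E] (f : E → ℝ) : Measurable (lscReg f) := by
  refine measurable_of_Ioi fun r => IsOpen.measurableSet ?_
  rw [isOpen_iff_eventually]
  intro x hx
  obtain ⟨s, hrs, hs⟩ := lt_lscReg_iff.1 hx
  exact hs.eventually_nhds.mono fun y hy => lt_lscReg_iff.2 ⟨s, hrs, hy⟩

theorem lscReg_le {E : Type*} [TopologicalSpace E] (f : E → ℝ) (x : E) :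
    lscReg f x ≤ ENNReal.ofReal (f x) :=
  le_of_forall_lt fun r hr => by
    obtain ⟨s, hrs, hs⟩ := lt_lscReg_iff.1 hr
    exact hrs.trans hs.self_of_nhds

/-- A log-concave function differs from its regularization only on the frontiers of countably many
superlevel sets, which are convex. -/
theorem LogConcave.ae_eq_lscReg {n : ℕ} {f : (Fin n → ℝ) → ℝ} (hf : LogConcave f) :
    ∀ᵐ x, lscReg f x = ENNReal.ofReal (f x) := by
  have hfr : ∀ᵐ x, ∀ r : ℚ, 0 ≤ r → x ∉ frontier {y | (r : ℝ) < f y} := by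
    refine ae_all_iff.2 fun r => eventually_imp_distrib_left.2 fun hr => ?_
    exact measure_eq_zero_iff_ae_notMem.1
      ((hf.convex_lt (by exact_mod_cast hr)).addHaar_frontier volume)
  filter_upwards [hfr] with x hx
  refine le_antisymm (lscReg_le f x) (le_of_forall_lt fun s hs => ?_)
  have hst : s ≠ ∞ := (hs.trans ENNReal.ofReal_lt_top).ne
  have hs' : s.toReal < f x := (ENNReal.lt_ofReal_iff_toReal_lt hst).1 hs
  obtain ⟨r, hsr, hrf⟩ := exists_rat_btwn hs'
  have hr0 : (0 : ℝ) ≤ r := ENNReal.toReal_nonneg.trans hsr.le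
  have hint : x ∈ interior {y | (r : ℝ) < f y} := by
    by_contra hcon
    exact hx r (by exact_mod_cast hr0) ⟨subset_closure hrf, hcon⟩
  refine lt_lscReg_iff.2 ⟨ENNReal.ofReal r, ?_, ?_⟩
  · exact (ENNReal.lt_ofReal_iff_toReal_lt hst).2 hsr
  · filter_upwards [mem_interior_iff_mem_nhds.1 hint] with y hy
    exact ENNReal.ofReal_lt_ofReal_iff'.2 ⟨hy, hr0.trans_lt hy⟩

theorem LogConcave.aemeasurable {n : ℕ} {f : (Fin n → ℝ) → ℝ} (hf : LogConcave f) :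
    AEMeasurable f := by
  refine ⟨fun x => (lscReg f x).toReal, (measurable_lscReg f).ennreal_toReal, ?_⟩
  filter_upwards [hf.ae_eq_lscReg] with x hx
  rw [hx, ENNReal.toReal_ofReal (hf.1 x)]

theorem LogConcave.lscReg_mul_le_sq_midpoint {n : ℕ} {f : (Fin n → ℝ) → ℝ} (hf : LogConcave f)
    (x y : Fin n → ℝ) :
    lscReg f x * lscReg f y ≤ lscReg f ((2⁻¹ : ℝ) • (x + y)) ^ 2 := by
  refine ENNReal.mul_le_of_forall_lt fun a ha b hb => ?_
  have ha' : ∀ᶠ z in 𝓝 x, a < ENNReal.ofReal (f z) := eventually_lt_of_lt_liminf ha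
  have hb' : ∀ᶠ z in 𝓝 y, b < ENNReal.ofReal (f z) := eventually_lt_of_lt_liminf hb
  obtain ⟨c, hc⟩ : ∃ c : ℝ≥0∞, c ^ 2 = a * b :=
    ⟨(a * b) ^ (2⁻¹ : ℝ), by rw [← ENNReal.rpow_natCast, ← ENNReal.rpow_mul]; norm_num⟩
  rw [← hc]
  refine pow_le_pow_left' (le_liminf_of_le (by isBoundedDefault) ?_) 2
  -- A point `z` near the midpoint is the midpoint of the equally shifted points `x`, `y`.
  set p := (2⁻¹ : ℝ) • (x + y) with hp
  have hx : Tendsto (fun z => x + (z - p)) (𝓝 p) (𝓝 x) := by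
    have : Tendsto (fun z => x + (z - p)) (𝓝 p) (𝓝 (x + (p - p))) :=
      (by fun_prop : Continuous fun z => x + (z - p)).tendsto p
    simpa using this
  have hy : Tendsto (fun z => y + (z - p)) (𝓝 p) (𝓝 y) := by
    have : Tendsto (fun z => y + (z - p)) (𝓝 p) (𝓝 (y + (p - p))) :=
      (by fun_prop : Continuous fun z => y + (z - p)).tendsto p
    simpa using this
  filter_upwards [hx.eventually ha', hy.eventually hb'] with z hz1 hz2
  have hmid := hf.mul_le_sq_midpoint (x + (z - p)) (y + (z - p))
  have hz : (2⁻¹ : ℝ) • (x + (z - p) + (y + (z - p))) = z := by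
    ext k
    simp [hp]
    ring
  rw [hz] at hmid
  refine le_of_not_gt fun hlt => ?_
  have h1 : a * b ≤ ENNReal.ofReal (f z) ^ 2 :=
    calc a * b ≤ ENNReal.ofReal (f (x + (z - p))) * ENNReal.ofReal (f (y + (z - p))) :=
          mul_le_mul' hz1.le hz2.le
      _ = ENNReal.ofReal (f (x + (z - p)) * f (y + (z - p))) :=
          (ENNReal.ofReal_mul (hf.1 _)).symm
      _ ≤ ENNReal.ofReal (f z ^ 2) := ENNReal.ofReal_le_ofReal hmid
      _ = ENNReal.ofReal (f z) ^ 2 := ENNReal.ofReal_pow (hf.1 _) 2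
  have h2 := ENNReal.mul_lt_mul hlt hlt
  rw [← sq, ← sq, hc] at h2
  exact absurd h1 (not_le.2 h2)

theorem LogConcave.volume_support_pos {n : ℕ} {f : (Fin n → ℝ) → ℝ} (hf : LogConcave f)
    (h : 0 < volume (tsupport f)) : 0 < volume (Function.support f) := by
  have hs : Function.support f = {x | 0 < f x} := by
    ext x
    exact ⟨fun hx => lt_of_le_of_ne (hf.1 x) (Ne.symm hx), fun hx => ne_of_gt hx⟩
  have hconv : Convex ℝ (Function.support f) := hs ▸ hf.convex_lt le_rfl
  refine pos_iff_ne_zero.2 fun h0 => h.ne' ?_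
  rw [tsupport, closure_eq_self_union_frontier]
  exact measure_union_null h0 (hconv.addHaar_frontier volume)

/-! ### Positive definite matrices -/

section Matrices

variable {n : ℕ}

theorem posDef_isUnit_det {C : Matrix (Fin n) (Fin n) ℝ} (hC : C.PosDef) : IsUnit C.det :=
  hC.det_pos.ne'.isUnit

theorem dotProduct_mulVec_comm {P : Matrix (Fin n) (Fin n) ℝ} (hP : P.IsHermitian)
    (x y : Fin n → ℝ) : x ⬝ᵥ (P *ᵥ y) = y ⬝ᵥ (P *ᵥ x) := by
  have hT : Pᵀ = P := by simpa [Matrix.IsHermitian] using hP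
  rw [Matrix.dotProduct_mulVec, ← Matrix.mulVec_transpose, hT, dotProduct_comm]

theorem dotProduct_mulVec_sub_sub {P : Matrix (Fin n) (Fin n) ℝ} (hP : P.IsHermitian)
    (x y : Fin n → ℝ) :
    (x - y) ⬝ᵥ (P *ᵥ (x - y)) = x ⬝ᵥ (P *ᵥ x) - 2 * (y ⬝ᵥ (P *ᵥ x)) + y ⬝ᵥ (P *ᵥ y) := by
  simp only [Matrix.mulVec_sub, dotProduct_sub, sub_dotProduct, dotProduct_mulVec_comm hP x y]
  ring

/-- A positive definite matrix has a factorization `C = B Bᵀ`. -/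
theorem exists_eq_mul_transpose {C : Matrix (Fin n) (Fin n) ℝ} (hC : C.PosDef) :
    ∃ B : Matrix (Fin n) (Fin n) ℝ, B.det ≠ 0 ∧ C = B * Bᵀ := by
  set U : Matrix (Fin n) (Fin n) ℝ := hC.1.eigenvectorUnitary.1
  set s : Fin n → ℝ := fun i => √(hC.1.eigenvalues i)
  have h : C = (U * Matrix.diagonal s) * (U * Matrix.diagonal s)ᵀ := by
    have hs : Matrix.diagonal s * Matrix.diagonal s = Matrix.diagonal hC.1.eigenvalues := by
      rw [Matrix.diagonal_mul_diagonal]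
      congr 1
      ext i
      exact Real.mul_self_sqrt (hC.eigenvalues_pos i).le
    have hU : C = U * Matrix.diagonal hC.1.eigenvalues * Uᵀ :=
      hC.1.spectral_theorem.trans (Unitary.conjStarAlgAut_apply _ _)
    rw [hU, ← hs, Matrix.transpose_mul, Matrix.diagonal_transpose]
    simp only [Matrix.mul_assoc]
  refine ⟨_, fun h0 => hC.det_pos.ne' ?_, h⟩
  rw [h, Matrix.det_mul, h0, zero_mul]

/-- The inequality `∑ (λᵢ - 1 - log λᵢ) ≥ 0` for the eigenvalues of a positive definite matrix. -/
theorem log_det_add_le_trace {A : Matrix (Fin n) (Fin n) ℝ} (hA : A.PosDef) :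
    Real.log A.det + n ≤ A.trace := by
  rw [hA.1.det_eq_prod_eigenvalues, hA.1.trace_eq_sum_eigenvalues]
  simp only [RCLike.ofReal_real_eq_id, id]
  rw [Real.log_prod fun i _ => (hA.eigenvalues_pos i).ne']
  have h := Finset.sum_le_sum fun i (_ : i ∈ Finset.univ) =>
    Real.log_le_sub_one_of_pos (hA.eigenvalues_pos i)
  rw [Finset.sum_sub_distrib] at h
  simp only [Finset.sum_const, Finset.card_univ, Fintype.card_fin, nsmul_eq_mul, mul_one] at h
  linarith

theorem eq_one_of_trace_le_log_det_add {A : Matrix (Fin n) (Fin n) ℝ} (hA : A.PosDef)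
    (h : A.trace ≤ Real.log A.det + n) : A = 1 := by
  have hev : ∀ i, hA.1.eigenvalues i = 1 := by
    by_contra! hne
    obtain ⟨j, hj⟩ := hne
    have hlt := Finset.sum_lt_sum (fun i (_ : i ∈ Finset.univ) =>
      Real.log_le_sub_one_of_pos (hA.eigenvalues_pos i))
      ⟨j, Finset.mem_univ j, Real.log_lt_sub_one_of_pos (hA.eigenvalues_pos j) hj⟩
    rw [hA.1.det_eq_prod_eigenvalues, hA.1.trace_eq_sum_eigenvalues] at h
    simp only [RCLike.ofReal_real_eq_id, id] at h
    rw [Real.log_prod fun i _ => (hA.eigenvalues_pos i).ne'] at h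
    rw [Finset.sum_sub_distrib] at hlt
    simp only [Finset.sum_const, Finset.card_univ, Fintype.card_fin, nsmul_eq_mul, mul_one] at hlt
    linarith
  have hdiag : Matrix.diagonal (RCLike.ofReal ∘ hA.1.eigenvalues) =
      (1 : Matrix (Fin n) (Fin n) ℝ) := by
    rw [← Matrix.diagonal_one]
    congr 1
    ext i
    simp [hev i]
  rw [hA.1.spectral_theorem, hdiag, map_one]

/-- For positive definite `S = B Bᵀ` and `C`, the matrix `Bᵀ C⁻¹ B` is similar to `C⁻¹ S`. -/
theorem posDef_transpose_mul_inv_mul {S C B : Matrix (Fin n) (Fin n) ℝ} (hC : C.PosDef)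
    (hB : B.det ≠ 0) (hS : S = B * Bᵀ) :
    (Bᵀ * C⁻¹ * B).PosDef ∧ (Bᵀ * C⁻¹ * B).trace = (C⁻¹ * S).trace ∧
      Real.log (Bᵀ * C⁻¹ * B).det = Real.log S.det - Real.log C.det := by
  refine ⟨?_, ?_, ?_⟩
  · have h := hC.inv.conjTranspose_mul_mul_same (B := B)
      (Matrix.mulVec_injective_iff_isUnit.2 ((Matrix.isUnit_iff_isUnit_det B).2 hB.isUnit))
    simpa using h
  · rw [hS, Matrix.mul_assoc, Matrix.trace_mul_comm, Matrix.mul_assoc]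
  · have hdet : (Bᵀ * C⁻¹ * B).det = S.det / C.det := by
      rw [hS]
      simp only [Matrix.det_mul, Matrix.det_transpose, Matrix.det_nonsing_inv,
        Ring.inverse_eq_inv']
      field_simp
    have hS0 : S.det ≠ 0 := by
      rw [hS, Matrix.det_mul, Matrix.det_transpose]
      exact mul_ne_zero hB hB
    rw [hdet, Real.log_div hS0 hC.det_pos.ne']

theorem log_det_add_le_log_det_add_trace {S C : Matrix (Fin n) (Fin n) ℝ} (hS : S.PosDef)
    (hC : C.PosDef) : Real.log S.det + n ≤ Real.log C.det + (C⁻¹ * S).trace := by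
  obtain ⟨B, hB, hSB⟩ := exists_eq_mul_transpose hS
  obtain ⟨h1, h2, h3⟩ := posDef_transpose_mul_inv_mul hC hB hSB
  have h := log_det_add_le_trace h1
  rw [h2, h3] at h
  linarith

theorem eq_of_log_det_add_trace_le {S C : Matrix (Fin n) (Fin n) ℝ} (hS : S.PosDef)
    (hC : C.PosDef) (h : Real.log C.det + (C⁻¹ * S).trace ≤ Real.log S.det + n) : C = S := by
  obtain ⟨B, hB, hSB⟩ := exists_eq_mul_transpose hS
  obtain ⟨h1, h2, h3⟩ := posDef_transpose_mul_inv_mul hC hB hSB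
  have h4 := eq_one_of_trace_le_log_det_add h1 (by rw [h2, h3]; linarith)
  have hBu : IsUnit B.det := hB.isUnit
  have hBu' : IsUnit Bᵀ.det := by rwa [Matrix.det_transpose]
  -- `Bᵀ C⁻¹ B = 1` gives `C⁻¹ (B Bᵀ) = 1`.
  have h5 : C⁻¹ * B * Bᵀ = 1 := by
    rw [Matrix.mul_assoc] at h4
    exact mul_eq_one_comm.1 h4
  rw [Matrix.mul_assoc, ← hSB] at h5
  calc C = C * (C⁻¹ * S) := by rw [h5, Matrix.mul_one]
    _ = S := Matrix.mul_nonsing_inv_cancel_left _ _ (posDef_isUnit_det hC)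

/-- Inversion reverses the Loewner order. -/
theorem posSemidef_inv_sub_inv {S C : Matrix (Fin n) (Fin n) ℝ} (hS : S.PosDef) (hC : C.PosDef)
    (h : ∀ v, v ⬝ᵥ (S *ᵥ v) ≤ v ⬝ᵥ (C *ᵥ v)) : (S⁻¹ - C⁻¹).PosSemidef := by
  refine Matrix.PosSemidef.of_dotProduct_mulVec_nonneg (hS.inv.1.sub hC.inv.1) fun w => ?_
  set u := C⁻¹ *ᵥ w
  have hCu : C *ᵥ u = w := by
    rw [Matrix.mulVec_mulVec, Matrix.mul_nonsing_inv _ (posDef_isUnit_det hC), Matrix.one_mulVec]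
  have hSS : S *ᵥ (S⁻¹ *ᵥ w) = w := by
    rw [Matrix.mulVec_mulVec, Matrix.mul_nonsing_inv _ (posDef_isUnit_det hS), Matrix.one_mulVec]
  -- Expand `(S⁻¹ w - u)ᵀ S (S⁻¹ w - u) ≥ 0` and use `uᵀ S u ≤ uᵀ C u = wᵀ C⁻¹ w`.
  have h1 := hS.posSemidef.dotProduct_mulVec_nonneg (S⁻¹ *ᵥ w - u)
  rw [star_trivial, dotProduct_mulVec_sub_sub hS.1, hSS] at h1
  have h2 := h u
  rw [hCu] at h2
  rw [star_trivial, Matrix.sub_mulVec, dotProduct_sub, dotProduct_comm w, dotProduct_comm w]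
  change 0 ≤ _ - u ⬝ᵥ w
  linarith

end Matrices

/-! ### Gaussian functions -/

section Gaussian

variable {n : ℕ}

/-- The exponential `exp (h ⬝ x - xᵀ P x / 2)`, a Gaussian function with precision `P`. -/
noncomputable def gaussianExp (P : Matrix (Fin n) (Fin n) ℝ) (h x : Fin n → ℝ) : ℝ :=
  Real.exp (h ⬝ᵥ x - 1 / 2 * (x ⬝ᵥ (P *ᵥ x)))

theorem continuous_gaussianExp (P : Matrix (Fin n) (Fin n) ℝ) (h : Fin n → ℝ) :
    Continuous (gaussianExp P h) := by
  unfold gaussianExp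
  fun_prop

theorem gaussianExp_pos (P : Matrix (Fin n) (Fin n) ℝ) (h x : Fin n → ℝ) :
    0 < gaussianExp P h x := Real.exp_pos _

theorem gaussianExp_add (P : Matrix (Fin n) (Fin n) ℝ) (h v x : Fin n → ℝ) :
    gaussianExp P (h + v) x = Real.exp (v ⬝ᵥ x) * gaussianExp P h x := by
  rw [gaussianExp, gaussianExp, ← Real.exp_add, add_dotProduct]
  ring_nf

theorem integrable_integral_exp_neg_dotProduct_self :
    Integrable (fun x : Fin n → ℝ => Real.exp (-(1 / 2) * (x ⬝ᵥ x))) ∧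
      ∫ x : Fin n → ℝ, Real.exp (-(1 / 2) * (x ⬝ᵥ x)) = √(2 * Real.pi) ^ n := by
  have h : (fun x : Fin n → ℝ => Real.exp (-(1 / 2) * (x ⬝ᵥ x))) =
      fun x => ∏ i, Real.exp (-(1 / 2) * (x i) ^ 2) := by
    ext x
    rw [← Real.exp_sum, ← Finset.mul_sum]
    simp only [dotProduct, sq]
  rw [h]
  refine ⟨?_, ?_⟩
  · exact Integrable.fintype_prod (f := fun _ (u : ℝ) => Real.exp (-(1 / 2) * u ^ 2))
      fun i => integrable_exp_neg_mul_sq (by norm_num)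
  · rw [integral_fintype_prod_volume_eq_pow (fun u : ℝ => Real.exp (-(1 / 2) * u ^ 2)),
      integral_gaussian, Fintype.card_fin]
    congr 2
    field_simp

/-- The substitution `x = B y` with `C = B Bᵀ` reduces the Gaussian integral to the standard
one. -/
theorem integrable_integral_exp_neg_quadratic {C : Matrix (Fin n) (Fin n) ℝ} (hC : C.PosDef) :
    Integrable (fun x : Fin n → ℝ => Real.exp (-(1 / 2) * (x ⬝ᵥ (C⁻¹ *ᵥ x)))) ∧
      ∫ x : Fin n → ℝ, Real.exp (-(1 / 2) * (x ⬝ᵥ (C⁻¹ *ᵥ x))) =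
        √((2 * Real.pi) ^ n * C.det) := by
  obtain ⟨B, hB, hCB⟩ := exists_eq_mul_transpose hC
  set F : (Fin n → ℝ) → ℝ := fun x => Real.exp (-(1 / 2) * (x ⬝ᵥ (C⁻¹ *ᵥ x)))
  have hF : Continuous F := by fun_prop
  have hL : Measurable (Matrix.toLin' B) :=
    (LinearMap.continuous_of_finiteDimensional (Matrix.toLin' B)).measurable
  have hq : ∀ y, F (Matrix.toLin' B y) = Real.exp (-(1 / 2) * (y ⬝ᵥ y)) := by
    intro y
    have hBu : IsUnit B.det := hB.isUnit
    have h1 : Bᵀ * C⁻¹ * B = 1 := by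
      rw [hCB, Matrix.mul_inv_rev, ← Matrix.mul_assoc,
        Matrix.mul_nonsing_inv _ (by rwa [Matrix.det_transpose]), Matrix.one_mul,
        Matrix.nonsing_inv_mul _ hBu]
    have h2 : (B *ᵥ y) ⬝ᵥ (C⁻¹ *ᵥ (B *ᵥ y)) = y ⬝ᵥ y := by
      rw [Matrix.mulVec_mulVec, dotProduct_comm, Matrix.dotProduct_mulVec, ← Matrix.mulVec_transpose,
        Matrix.mulVec_mulVec, ← Matrix.mul_assoc, h1, Matrix.one_mulVec]
    simp only [F, Matrix.toLin'_apply, h2]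
  have hmap := Real.map_matrix_volume_pi_eq_smul_volume_pi hB
  obtain ⟨hi, hI⟩ := integrable_integral_exp_neg_dotProduct_self (n := n)
  refine ⟨?_, ?_⟩
  · have h1 : Integrable F (Measure.map (Matrix.toLin' B) volume) := by
      rw [integrable_map_measure hF.aestronglyMeasurable hL.aemeasurable]
      exact hi.congr (Eventually.of_forall fun y => (hq y).symm)
    rw [hmap, integrable_smul_measure (by simpa using hB) (by simp)] at h1
    exact h1
  · have h1 : ∫ x, F x ∂(Measure.map (Matrix.toLin' B) volume) = √(2 * Real.pi) ^ n := by
      rw [integral_map hL.aemeasurable hF.aestronglyMeasurable]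
      simp only [hq, hI]
    rw [hmap, integral_smul_measure, ENNReal.toReal_ofReal (abs_nonneg _), smul_eq_mul] at h1
    have h2 : ∫ x, F x = |B.det| * √(2 * Real.pi) ^ n := by
      rw [← h1, abs_inv, ← mul_assoc, mul_inv_cancel₀ (abs_ne_zero.2 hB), one_mul]
    have h3 : (2 * Real.pi) ^ n * (B.det * B.det) = (|B.det| * √(2 * Real.pi) ^ n) ^ 2 := by
      rw [mul_pow |B.det|, sq_abs, ← pow_mul, mul_comm n 2, pow_mul, Real.sq_sqrt (by positivity)]
      ring
    rw [h2, hCB, Matrix.det_mul, Matrix.det_transpose, h3, Real.sqrt_sq (by positivity)]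

theorem sqrt_det_pos {C : Matrix (Fin n) (Fin n) ℝ} (hC : C.PosDef) :
    0 < √((2 * Real.pi) ^ n * C.det) :=
  Real.sqrt_pos.2 (mul_pos (by positivity) hC.det_pos)

theorem gaussianDensity_pos (m : Fin n → ℝ) {C : Matrix (Fin n) (Fin n) ℝ} (hC : C.PosDef)
    (x : Fin n → ℝ) : 0 < gaussianDensity m C x :=
  mul_pos (inv_pos.2 (sqrt_det_pos hC)) (Real.exp_pos _)

theorem continuous_gaussianDensity (m : Fin n → ℝ) (C : Matrix (Fin n) (Fin n) ℝ) :
    Continuous (gaussianDensity m C) := by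
  unfold gaussianDensity
  fun_prop

theorem integrable_gaussianDensity (m : Fin n → ℝ) {C : Matrix (Fin n) (Fin n) ℝ}
    (hC : C.PosDef) : Integrable (gaussianDensity m C) :=
  ((integrable_integral_exp_neg_quadratic hC).1.comp_sub_right m).const_mul _

theorem integral_gaussianDensity (m : Fin n → ℝ) {C : Matrix (Fin n) (Fin n) ℝ}
    (hC : C.PosDef) : ∫ x, gaussianDensity m C x = 1 := by
  unfold gaussianDensity
  rw [integral_const_mul,
    integral_sub_right_eq_self (fun x => Real.exp (-(1 / 2) * (x ⬝ᵥ (C⁻¹ *ᵥ x)))) m,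
    (integrable_integral_exp_neg_quadratic hC).2, inv_mul_cancel₀ (sqrt_det_pos hC).ne']

theorem isProbabilityMeasure_gaussianLaw (m : Fin n → ℝ) {C : Matrix (Fin n) (Fin n) ℝ}
    (hC : C.PosDef) : IsProbabilityMeasure (gaussianLaw m C) := by
  refine ⟨?_⟩
  rw [gaussianLaw, withDensity_apply _ MeasurableSet.univ, setLIntegral_univ,
    ← ofReal_integral_eq_lintegral_ofReal (integrable_gaussianDensity m hC)
      (Eventually.of_forall fun x => (gaussianDensity_pos m hC x).le),
    integral_gaussianDensity m hC, ENNReal.ofReal_one]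

theorem gaussianDensity_eq_mul_gaussianExp (m : Fin n → ℝ) {C : Matrix (Fin n) (Fin n) ℝ}
    (hC : C.PosDef) :
    ∃ s : ℝ, 0 < s ∧ ∀ x, gaussianDensity m C x = s * gaussianExp C⁻¹ (C⁻¹ *ᵥ m) x := by
  refine ⟨(√((2 * Real.pi) ^ n * C.det))⁻¹ * Real.exp (-(1 / 2) * (m ⬝ᵥ (C⁻¹ *ᵥ m))),
    mul_pos (inv_pos.2 (sqrt_det_pos hC)) (Real.exp_pos _), fun x => ?_⟩
  rw [gaussianDensity, gaussianExp, mul_assoc, ← Real.exp_add, dotProduct_mulVec_sub_sub hC.inv.1,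
    dotProduct_mulVec_comm hC.inv.1 m x, dotProduct_comm (C⁻¹ *ᵥ m) x]
  congr 2
  ring

theorem gaussianExp_eq_mul_gaussianDensity {P : Matrix (Fin n) (Fin n) ℝ} (hP : P.PosDef)
    (h : Fin n → ℝ) :
    ∃ s : ℝ, 0 < s ∧ ∀ x, gaussianExp P h x = s * gaussianDensity (P⁻¹ *ᵥ h) P⁻¹ x := by
  obtain ⟨s, hs, hx⟩ := gaussianDensity_eq_mul_gaussianExp (P⁻¹ *ᵥ h) hP.inv
  refine ⟨s⁻¹, inv_pos.2 hs, fun x => ?_⟩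
  have hPu := posDef_isUnit_det hP
  rw [hx, Matrix.nonsing_inv_nonsing_inv _ hPu, Matrix.mulVec_mulVec,
    Matrix.mul_nonsing_inv _ hPu, Matrix.one_mulVec, inv_mul_cancel_left₀ hs.ne']

theorem integrable_gaussianExp {P : Matrix (Fin n) (Fin n) ℝ} (hP : P.PosDef)
    (h : Fin n → ℝ) : Integrable (gaussianExp P h) := by
  obtain ⟨s, -, hx⟩ := gaussianExp_eq_mul_gaussianDensity hP h
  rw [show gaussianExp P h = fun x => s * gaussianDensity (P⁻¹ *ᵥ h) P⁻¹ x from funext hx]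
  exact (integrable_gaussianDensity _ hP.inv).const_mul s

/-- A product of Gaussian factors over a nonempty set is a Gaussian function whose precision is the
sum of the precisions. -/
theorem exists_prod_eq_gaussianExp {I : Type*} {f : I → (Fin n → ℝ) → ℝ} {m : I → Fin n → ℝ}
    {C : I → Matrix (Fin n) (Fin n) ℝ} (hf : ∀ j, IsGaussianFactor (f j) (m j) (C j))
    {J : Finset I} (hJ : J.Nonempty) :
    ∃ (P : Matrix (Fin n) (Fin n) ℝ) (h : Fin n → ℝ) (s : ℝ), P.PosDef ∧ 0 < s ∧
      ∀ x, ∏ j ∈ J, f j x = s * gaussianExp P h x := by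
  have hj : ∀ j, ∃ s : ℝ, 0 < s ∧
      ∀ x, f j x = s * gaussianExp (C j)⁻¹ ((C j)⁻¹ *ᵥ m j) x := by
    intro j
    obtain ⟨hC, s, hs, hx⟩ := hf j
    obtain ⟨s', hs', hx'⟩ := gaussianDensity_eq_mul_gaussianExp (m j) hC
    exact ⟨s * s', mul_pos hs hs', fun x => by rw [hx, hx', mul_assoc]⟩
  choose s hs hx using hj
  refine ⟨∑ j ∈ J, (C j)⁻¹, ∑ j ∈ J, (C j)⁻¹ *ᵥ m j, ∏ j ∈ J, s j,
    Matrix.posDef_sum hJ fun j _ => (hf j).1.inv, Finset.prod_pos fun j _ => hs j, fun x => ?_⟩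
  simp only [hx, Finset.prod_mul_distrib, gaussianExp]
  rw [← Real.exp_sum, Finset.sum_sub_distrib, ← Finset.mul_sum, sum_dotProduct,
    Matrix.sum_mulVec, dotProduct_sum]

end Gaussian

/-! ### Exponential moments and the variance -/

theorem one_add_sq_div_two_le_cosh (x : ℝ) : 1 + x ^ 2 / 2 ≤ Real.cosh x := by
  have h1 : Real.cosh x = 1 + 2 * Real.sinh (x / 2) ^ 2 := by
    have h := Real.cosh_two_mul (x / 2)
    rw [mul_div_cancel₀ x two_ne_zero, Real.cosh_sq] at h
    linarith
  have h2 : (x / 2) ^ 2 ≤ Real.sinh (x / 2) ^ 2 := by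
    rw [sq_le_sq, Real.abs_sinh]
    exact Real.self_le_sinh_iff.2 (abs_nonneg (x / 2))
  rw [h1]
  linarith

section Exponential

variable {Ω : Type*} {mΩ : MeasurableSpace Ω} {Q : Measure Ω} {Y : Ω → ℝ}

theorem memLp_two_of_integrable_exp (hY : AEStronglyMeasurable Y Q)
    (h1 : Integrable (fun x => Real.exp (Y x)) Q)
    (h2 : Integrable (fun x => Real.exp (-Y x)) Q) : MemLp Y 2 Q := by
  rw [memLp_two_iff_integrable_sq hY]
  refine (h1.add h2).mono' (hY.pow 2) (Eventually.of_forall fun x => ?_)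
  have h := one_add_sq_div_two_le_cosh (Y x)
  rw [Real.cosh_eq] at h
  simp only [Real.norm_eq_abs, abs_sq, Pi.add_apply]
  linarith

/-- With an independent copy `Y'` of `Y` the right-hand side is the mean of `cosh (Y - Y')`, and
`cosh y ≥ 1 + y ^ 2 / 2`. -/
theorem one_add_variance_le_integral_exp_mul [IsProbabilityMeasure Q] (hY : MemLp Y 2 Q)
    (h1 : Integrable (fun x => Real.exp (Y x)) Q)
    (h2 : Integrable (fun x => Real.exp (-Y x)) Q) :
    1 + Var[Y; Q] ≤ (∫ x, Real.exp (Y x) ∂Q) * ∫ x, Real.exp (-Y x) ∂Q := by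
  set a := ∫ x, Real.exp (Y x) ∂Q
  set b := ∫ x, Real.exp (-Y x) ∂Q
  set e := ∫ x, Y x ∂Q
  set e2 := ∫ x, Y x ^ 2 ∂Q
  have hYi : Integrable Y Q := hY.integrable one_le_two
  have hY2 : Integrable (fun x => Y x ^ 2) Q := hY.integrable_sq
  have quad : ∀ p r : ℝ, Integrable (fun x => Y x ^ 2 / 2 - p * Y x + r) Q ∧
      ∫ x, (Y x ^ 2 / 2 - p * Y x + r) ∂Q = e2 / 2 - p * e + r := by
    intro p r
    have hs : Integrable (fun x => Y x ^ 2 / 2 - p * Y x) Q :=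
      (hY2.div_const 2).sub (hYi.const_mul p)
    refine ⟨hs.add (integrable_const r), ?_⟩
    rw [integral_add hs (integrable_const _),
      integral_sub (hY2.div_const 2) (hYi.const_mul p), integral_div, integral_const_mul,
      integral_const, probReal_univ, one_smul]
  have hcosh : ∀ y x, (Real.exp (Y x) * Real.exp (-y) + Real.exp (-Y x) * Real.exp y) / 2 =
      Real.cosh (Y x - y) := fun y x => by
    rw [Real.cosh_eq, ← Real.exp_add, ← Real.exp_add]
    ring_nf
  -- First integrate over one of the two copies.
  have inner : ∀ y : ℝ, e2 / 2 - y * e + (1 + y ^ 2 / 2) ≤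
      (a * Real.exp (-y) + b * Real.exp y) / 2 := by
    intro y
    have hr : ∫ x, (Real.exp (Y x) * Real.exp (-y) + Real.exp (-Y x) * Real.exp y) / 2 ∂Q =
        (a * Real.exp (-y) + b * Real.exp y) / 2 := by
      rw [integral_div, integral_add (h1.mul_const _) (h2.mul_const _), integral_mul_const,
        integral_mul_const]
    rw [← (quad y (1 + y ^ 2 / 2)).2, ← hr]
    refine integral_mono (quad _ _).1 (((h1.mul_const _).add (h2.mul_const _)).div_const 2)
      fun x => ?_
    simp only [hcosh]
    have := one_add_sq_div_two_le_cosh (Y x - y)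
    linarith
  have hr : ∫ x, (a * Real.exp (-Y x) + b * Real.exp (Y x)) / 2 ∂Q = a * b := by
    rw [integral_div, integral_add (h2.const_mul _) (h1.const_mul _), integral_const_mul,
      integral_const_mul]
    change (a * b + b * a) / 2 = a * b
    ring
  have hvar : Var[Y; Q] = e2 - e ^ 2 := variance_eq_sub hY
  have hl : 1 + Var[Y; Q] = ∫ x, (Y x ^ 2 / 2 - e * Y x + (1 + e2 / 2)) ∂Q := by
    rw [(quad e (1 + e2 / 2)).2, hvar]
    ring
  rw [hl, ← hr]
  refine integral_mono (quad _ _).1 (((h2.const_mul _).add (h1.const_mul _)).div_const 2)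
    fun x => ?_
  have := inner (Y x)
  simp only
  linarith

end Exponential

theorem le_of_forall_one_add_sq_mul_le_exp {V σ : ℝ}
    (h : ∀ r : ℝ, 1 + r ^ 2 * V ≤ Real.exp (r ^ 2 * σ)) : V ≤ σ := by
  -- Both sides agree at `r ^ 2 = 0`; compare the derivatives there.
  have hd : HasDerivAt (fun s : ℝ => Real.exp (s * σ)) σ 0 := by
    have := ((hasDerivAt_id (0 : ℝ)).mul_const σ).exp
    simpa using this
  have ht := hd.tendsto_slope_zero_right
  refine ge_of_tendsto ht ?_
  filter_upwards [self_mem_nhdsWithin] with s hs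
  have hs0 : (0 : ℝ) < s := hs
  have h1 := h √s
  rw [Real.sq_sqrt hs0.le] at h1
  simp only [zero_add, zero_mul, Real.exp_zero, smul_eq_mul]
  rw [inv_mul_eq_div, le_div_iff₀ hs0]
  linarith

/-! ### Mean vector and covariance matrix -/

section Moments

variable {n : ℕ}

/-- The vector of the means of the coordinates. -/
noncomputable def meanVec (Q : Measure (Fin n → ℝ)) : Fin n → ℝ := fun k => ∫ x, x k ∂Q

/-- The matrix of the covariances of the coordinates. -/
noncomputable def covMatrix (Q : Measure (Fin n → ℝ)) : Matrix (Fin n) (Fin n) ℝ :=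
  Matrix.of fun k l => cov[fun x => x k, fun x => x l; Q]

variable {Q : Measure (Fin n → ℝ)}

theorem memLp_dotProduct (hQ : ∀ k, MemLp (fun x : Fin n → ℝ => x k) 2 Q) (v : Fin n → ℝ) :
    MemLp (fun x => v ⬝ᵥ x) 2 Q := by
  have h := memLp_finsetSum Finset.univ fun k _ => (hQ k).const_mul (v k)
  exact h

variable [IsProbabilityMeasure Q]

theorem dotProduct_covMatrix_mulVec (hQ : ∀ k, MemLp (fun x : Fin n → ℝ => x k) 2 Q)
    (v : Fin n → ℝ) : v ⬝ᵥ (covMatrix Q *ᵥ v) = Var[fun x => v ⬝ᵥ x; Q] := by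
  rw [← covariance_self (memLp_dotProduct hQ v).aestronglyMeasurable.aemeasurable]
  simp only [dotProduct]
  rw [covariance_fun_sum_fun_sum (fun k => (hQ k).const_mul (v k))
    (fun k => (hQ k).const_mul (v k))]
  simp only [covariance_const_mul_left, covariance_const_mul_right, Matrix.mulVec, dotProduct,
    covMatrix, Matrix.of_apply, Finset.mul_sum]
  refine Finset.sum_congr rfl fun k _ => Finset.sum_congr rfl fun l _ => ?_
  ring

theorem volume_hyperplane {v : Fin n → ℝ} (hv : v ≠ 0) (c : ℝ) :
    volume {x : Fin n → ℝ | v ⬝ᵥ x = c} = 0 := by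
  let A : AffineSubspace ℝ (Fin n → ℝ) :=
    { carrier := {x | v ⬝ᵥ x = c}
      smul_vsub_vadd_mem' := by
        intro r p₁ p₂ p₃ h₁ h₂ h₃
        change v ⬝ᵥ (r • (p₁ - p₂) + p₃) = c
        rw [dotProduct_add, dotProduct_smul, dotProduct_sub, h₁, h₂, h₃]
        simp }
  refine Measure.addHaar_affineSubspace volume A fun hA => hv ?_
  have h0 : (0 : Fin n → ℝ) ∈ A := hA ▸ AffineSubspace.mem_top ℝ _ _
  have h1 : v ∈ A := hA ▸ AffineSubspace.mem_top ℝ _ _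
  have h0' : v ⬝ᵥ (0 : Fin n → ℝ) = c := h0
  have h1' : v ⬝ᵥ v = c := h1
  rw [dotProduct_zero] at h0'
  exact dotProduct_self_eq_zero.1 (h1'.trans h0'.symm)

/-- An absolutely continuous law is not concentrated on a hyperplane, so its covariance matrix is
positive definite. -/
theorem posDef_covMatrix (hQ : ∀ k, MemLp (fun x : Fin n → ℝ => x k) 2 Q) (hac : Q ≪ volume) :
    (covMatrix Q).PosDef := by
  refine Matrix.PosDef.of_dotProduct_mulVec_pos ?_ fun v hv => ?_
  · ext k l
    simp only [Matrix.conjTranspose_apply, star_trivial, covMatrix, Matrix.of_apply]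
    exact covariance_comm _ _
  rw [star_trivial, dotProduct_covMatrix_mulVec hQ]
  refine lt_of_le_of_ne (variance_nonneg _ _) fun h0 => ?_
  have hae := ae_eq_integral_of_variance_eq_zero (memLp_dotProduct hQ v) h0.symm
  have hnull : Q {x | v ⬝ᵥ x = ∫ y, v ⬝ᵥ y ∂Q} = 0 := hac (volume_hyperplane hv _)
  have huniv : Q univ = 0 := by
    refine measure_mono_null (fun x _ => ?_) (measure_union_null hnull (ae_iff.1 hae))
    exact em _
  simp at huniv

theorem integral_coord_sub_mul (hQ : ∀ k, MemLp (fun x : Fin n → ℝ => x k) 2 Q) (m : Fin n → ℝ)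
    (k l : Fin n) :
    ∫ x, (x k - m k) * (x l - m l) ∂Q =
      covMatrix Q k l + (meanVec Q k - m k) * (meanVec Q l - m l) := by
  have hi : ∀ k, Integrable (fun x : Fin n → ℝ => x k) Q := fun k => (hQ k).integrable one_le_two
  have hm : ∀ k, MemLp (fun x : Fin n → ℝ => x k - m k) 2 Q := fun k =>
    (hQ k).sub (memLp_const _)
  have hmean : ∀ k, ∫ x, (x k - m k) ∂Q = meanVec Q k - m k := fun k => by
    rw [integral_sub (hi k) (integrable_const _), integral_const, probReal_univ, one_smul]
    rfl
  have h := covariance_eq_sub (hm k) (hm l)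
  rw [covariance_sub_const_left (hi k), covariance_sub_const_right (hi l), hmean, hmean] at h
  simp only [covMatrix, Matrix.of_apply, h, Pi.mul_apply]
  ring

theorem integrable_quadratic (hQ : ∀ k, MemLp (fun x : Fin n → ℝ => x k) 2 Q) (m : Fin n → ℝ)
    (A : Matrix (Fin n) (Fin n) ℝ) :
    Integrable (fun x => (x - m) ⬝ᵥ (A *ᵥ (x - m))) Q := by
  simp only [dotProduct, Matrix.mulVec, Finset.mul_sum, Pi.sub_apply]
  refine integrable_finsetSum _ fun k _ => integrable_finsetSum _ fun l _ => ?_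
  have hm : ∀ k, MemLp (fun x : Fin n → ℝ => x k - m k) 2 Q := fun k =>
    (hQ k).sub (memLp_const _)
  refine (((hm k).integrable_mul (hm l)).const_mul (A k l)).congr (Eventually.of_forall fun x => ?_)
  simp only [Pi.mul_apply]
  ring

theorem integral_quadratic (hQ : ∀ k, MemLp (fun x : Fin n → ℝ => x k) 2 Q) (m : Fin n → ℝ)
    (A : Matrix (Fin n) (Fin n) ℝ) :
    ∫ x, (x - m) ⬝ᵥ (A *ᵥ (x - m)) ∂Q =
      (A * covMatrix Q).trace + (meanVec Q - m) ⬝ᵥ (A *ᵥ (meanVec Q - m)) := by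
  have hm : ∀ k, MemLp (fun x : Fin n → ℝ => x k - m k) 2 Q := fun k =>
    (hQ k).sub (memLp_const _)
  have hint : ∀ k l, Integrable (fun x : Fin n → ℝ => A k l * ((x k - m k) * (x l - m l))) Q :=
    fun k l => ((hm k).integrable_mul (hm l)).const_mul (A k l)
  have hexp : ∀ y : Fin n → ℝ, y ⬝ᵥ (A *ᵥ y) = ∑ k, ∑ l, A k l * (y k * y l) := fun y => by
    simp only [dotProduct, Matrix.mulVec, Finset.mul_sum]
    exact Finset.sum_congr rfl fun k _ => Finset.sum_congr rfl fun l _ => by ring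
  have hsymm : ∀ k l, covMatrix Q k l = covMatrix Q l k := fun k l => covariance_comm _ _
  simp only [hexp, Pi.sub_apply]
  rw [integral_finsetSum _ fun k _ => integrable_finsetSum _ fun l _ => hint k l]
  simp only [integral_finsetSum _ fun l _ => hint _ l, integral_const_mul,
    integral_coord_sub_mul hQ, mul_add, Finset.sum_add_distrib, Matrix.trace, Matrix.diag,
    Matrix.mul_apply]
  congr 1
  exact Finset.sum_congr rfl fun k _ => Finset.sum_congr rfl fun l _ => by rw [hsymm]

end Moments

/-! ### Moment matching minimizes the Kullback–Leibler divergence -/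

section KullbackLeibler

variable {n : ℕ} {q : (Fin n → ℝ) → ℝ}

theorem log_gaussianDensity (m : Fin n → ℝ) {C : Matrix (Fin n) (Fin n) ℝ} (hC : C.PosDef)
    (x : Fin n → ℝ) :
    Real.log (gaussianDensity m C x) =
      -(Real.log ((2 * Real.pi) ^ n) + Real.log C.det) / 2 -
        (x - m) ⬝ᵥ (C⁻¹ *ᵥ (x - m)) / 2 := by
  rw [gaussianDensity, Real.log_mul (inv_pos.2 (sqrt_det_pos hC)).ne' (Real.exp_pos _).ne',
    Real.log_inv, Real.log_exp, Real.log_sqrt (mul_pos (by positivity) hC.det_pos).le,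
    Real.log_mul (by positivity) hC.det_pos.ne']
  ring

theorem withDensity_absolutelyContinuous_gaussianLaw (m : Fin n → ℝ)
    {C : Matrix (Fin n) (Fin n) ℝ} (hC : C.PosDef) :
    volume.withDensity (fun x => ENNReal.ofReal (q x)) ≪ gaussianLaw m C :=
  (withDensity_absolutelyContinuous _ _).trans <|
    withDensity_absolutelyContinuous'
      (continuous_gaussianDensity m C).measurable.ennreal_ofReal.aemeasurable
      (Eventually.of_forall fun x => by simpa using gaussianDensity_pos m hC x)

theorem llr_withDensity_gaussianLaw (hq : AEMeasurable q)
    [IsProbabilityMeasure (volume.withDensity fun x => ENNReal.ofReal (q x))]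
    (m : Fin n → ℝ) {C : Matrix (Fin n) (Fin n) ℝ} (hC : C.PosDef) :
    llr (volume.withDensity fun x => ENNReal.ofReal (q x)) (gaussianLaw m C)
      =ᵐ[volume.withDensity fun x => ENNReal.ofReal (q x)]
        fun x => Real.log (q x) - Real.log (gaussianDensity m C x) := by
  set Q := volume.withDensity fun x => ENNReal.ofReal (q x)
  have hac : Q ≪ volume := withDensity_absolutelyContinuous _ _
  have h1 : Q.rnDeriv (gaussianLaw m C) =ᵐ[volume]
      fun x => (ENNReal.ofReal (gaussianDensity m C x))⁻¹ * Q.rnDeriv volume x :=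
    Measure.rnDeriv_withDensity_right Q volume
      (continuous_gaussianDensity m C).measurable.ennreal_ofReal.aemeasurable
      (Eventually.of_forall fun x => by simpa using gaussianDensity_pos m hC x)
      (Eventually.of_forall fun x => ENNReal.ofReal_ne_top)
  have h2 : Q.rnDeriv volume =ᵐ[volume] fun x => ENNReal.ofReal (q x) :=
    Measure.rnDeriv_withDensity₀ volume hq.ennreal_ofReal
  have h3 : ∀ᵐ x ∂Q, 0 < q x :=
    (ae_withDensity_iff' hq.ennreal_ofReal).2
      (Eventually.of_forall fun x hx => by simpa using hx)
  filter_upwards [hac.ae_le h1, hac.ae_le h2, h3] with x hx1 hx2 hx3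
  have hg := gaussianDensity_pos m hC x
  rw [llr, hx1, hx2, ENNReal.toReal_mul, ENNReal.toReal_inv, ENNReal.toReal_ofReal hg.le,
    ENNReal.toReal_ofReal hx3.le, Real.log_mul (inv_ne_zero hg.ne') hx3.ne', Real.log_inv]
  ring

/-- The divergence from `Q` to a Gaussian depends on `Q` only through its entropy and its first two
moments. -/
theorem klDiv_gaussianLaw_eq (hq : AEMeasurable q)
    {Q : Measure (Fin n → ℝ)} [IsProbabilityMeasure Q]
    (hQq : Q = volume.withDensity fun x => ENNReal.ofReal (q x))
    (hQ : ∀ k, MemLp (fun x : Fin n → ℝ => x k) 2 Q)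
    (hlog : Integrable (fun x => Real.log (q x)) Q)
    (m : Fin n → ℝ) {C : Matrix (Fin n) (Fin n) ℝ} (hC : C.PosDef) :
    klDiv Q (gaussianLaw m C) ≠ ∞ ∧
      (klDiv Q (gaussianLaw m C)).toReal =
        (∫ x, Real.log (q x) ∂Q) + Real.log ((2 * Real.pi) ^ n) / 2 +
          (Real.log C.det + (C⁻¹ * covMatrix Q).trace +
            (meanVec Q - m) ⬝ᵥ (C⁻¹ *ᵥ (meanVec Q - m))) / 2 := by
  subst hQq
  set Q := volume.withDensity fun x => ENNReal.ofReal (q x)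
  have hac : Q ≪ gaussianLaw m C := withDensity_absolutelyContinuous_gaussianLaw m hC
  have hllr := llr_withDensity_gaussianLaw hq m hC
  have : IsProbabilityMeasure (gaussianLaw m C) := isProbabilityMeasure_gaussianLaw m hC
  have hquad := integrable_quadratic hQ m C⁻¹
  have hg : Integrable (fun x => Real.log (gaussianDensity m C x)) Q := by
    simp only [log_gaussianDensity m hC]
    exact (integrable_const _).sub (hquad.div_const 2)
  refine ⟨klDiv_ne_top hac ((integrable_congr hllr).2 (hlog.sub hg)), ?_⟩
  rw [toReal_klDiv_of_measure_eq hac (by simp), integral_congr_ae hllr, integral_sub hlog hg]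
  simp only [log_gaussianDensity m hC]
  rw [integral_sub (integrable_const _) (hquad.div_const 2), integral_const, probReal_univ,
    one_smul, integral_div, integral_quadratic hQ]
  ring

theorem isGaussianKLMinimizer_meanVec_covMatrix (hq : AEMeasurable q)
    {Q : Measure (Fin n → ℝ)} [IsProbabilityMeasure Q]
    (hQq : Q = volume.withDensity fun x => ENNReal.ofReal (q x))
    (hQ : ∀ k, MemLp (fun x : Fin n → ℝ => x k) 2 Q)
    (hlog : Integrable (fun x => Real.log (q x)) Q) :
    IsGaussianKLMinimizer Q (meanVec Q) (covMatrix Q) ∧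
      ∀ m C, IsGaussianKLMinimizer Q m C → m = meanVec Q ∧ C = covMatrix Q := by
  have hS : (covMatrix Q).PosDef :=
    posDef_covMatrix hQ (hQq ▸ withDensity_absolutelyContinuous _ _)
  obtain ⟨htop, hval⟩ := klDiv_gaussianLaw_eq hq hQq hQ hlog (meanVec Q) hS
  rw [Matrix.nonsing_inv_mul _ (posDef_isUnit_det hS), Matrix.trace_one, Fintype.card_fin,
    sub_self, zero_dotProduct, add_zero] at hval
  have hnonneg : ∀ (m : Fin n → ℝ) {C : Matrix (Fin n) (Fin n) ℝ}, C.PosDef →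
      0 ≤ (meanVec Q - m) ⬝ᵥ (C⁻¹ *ᵥ (meanVec Q - m)) := fun m C hC => by
    simpa using hC.inv.posSemidef.dotProduct_mulVec_nonneg (meanVec Q - m)
  refine ⟨⟨hS, fun m C hC => ?_⟩, fun m C hmin => ?_⟩
  · obtain ⟨htop', hval'⟩ := klDiv_gaussianLaw_eq hq hQq hQ hlog m hC
    rw [← ENNReal.toReal_le_toReal htop htop', hval, hval']
    have h1 := log_det_add_le_log_det_add_trace hS hC
    have h2 := hnonneg m hC
    linarith
  · obtain ⟨hC, hle⟩ := hmin
    obtain ⟨htop', hval'⟩ := klDiv_gaussianLaw_eq hq hQq hQ hlog m hC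
    have hle' := hle (meanVec Q) (covMatrix Q) hS
    rw [← ENNReal.toReal_le_toReal htop' htop, hval, hval'] at hle'
    have h1 := log_det_add_le_log_det_add_trace hS hC
    have h2 := hnonneg m hC
    refine ⟨?_, eq_of_log_det_add_trace_le hS hC (by linarith)⟩
    by_contra hne
    have h3 := hC.inv.dotProduct_mulVec_pos (sub_ne_zero.2 (Ne.symm hne))
    rw [star_trivial] at h3
    linarith

end KullbackLeibler

/-! ### Log-concave functions times Gaussians -/

section LogConcaveGaussian

variable {n : ℕ} {t : (Fin n → ℝ) → ℝ} {M : ℝ} {P : Matrix (Fin n) (Fin n) ℝ}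

theorem integrable_mul_gaussianExp (ht : LogConcave t) (hM : ∀ x, t x ≤ M) (hP : P.PosDef)
    (h : Fin n → ℝ) : Integrable fun x => t x * gaussianExp P h x :=
  (integrable_gaussianExp hP h).bdd_mul (c := M) ht.aemeasurable.aestronglyMeasurable
    (Eventually.of_forall fun x => by rw [Real.norm_of_nonneg (ht.1 x)]; exact hM x)

theorem integral_mul_gaussianExp_pos (ht : LogConcave t) (hM : ∀ x, t x ≤ M)
    (hsupp : 0 < volume (tsupport t)) (hP : P.PosDef) (h : Fin n → ℝ) :
    0 < ∫ x, t x * gaussianExp P h x := by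
  rw [integral_pos_iff_support_of_nonneg
    (fun x => mul_nonneg (ht.1 x) (gaussianExp_pos P h x).le) (integrable_mul_gaussianExp ht hM hP h)]
  have : Function.support (fun x => t x * gaussianExp P h x) = Function.support t := by
    ext x
    simp [(gaussianExp_pos P h x).ne']
  rw [this]
  exact ht.volume_support_pos hsupp

/-- Completing the square in `x - y`. -/
theorem gaussianExp_add_mul_gaussianExp_sub_le (hP : P.PosDef) (h v x y : Fin n → ℝ) :
    gaussianExp P (h + v) x * gaussianExp P (h - v) y ≤
      Real.exp (v ⬝ᵥ (P⁻¹ *ᵥ v)) * gaussianExp P h ((2⁻¹ : ℝ) • (x + y)) ^ 2 := by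
  rw [gaussianExp, gaussianExp, gaussianExp, ← Real.exp_add, ← Real.exp_nat_mul, ← Real.exp_add,
    Real.exp_le_exp]
  have hsq := hP.posSemidef.dotProduct_mulVec_nonneg ((x - y) - (2 : ℝ) • (P⁻¹ *ᵥ v))
  have hPv : P *ᵥ (P⁻¹ *ᵥ v) = v := by
    rw [Matrix.mulVec_mulVec, Matrix.mul_nonsing_inv _ (posDef_isUnit_det hP), Matrix.one_mulVec]
  rw [star_trivial, dotProduct_mulVec_sub_sub hP.1, dotProduct_mulVec_sub_sub hP.1,
    dotProduct_mulVec_comm hP.1 ((2 : ℝ) • (P⁻¹ *ᵥ v)) (x - y)] at hsq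
  simp only [Matrix.mulVec_smul, hPv, dotProduct_smul, smul_dotProduct, sub_dotProduct,
    smul_eq_mul, dotProduct_comm (P⁻¹ *ᵥ v) v] at hsq
  simp only [Matrix.mulVec_smul, Matrix.mulVec_add, dotProduct_smul, smul_dotProduct,
    dotProduct_add, add_dotProduct, sub_dotProduct, smul_eq_mul, Nat.cast_ofNat]
  rw [dotProduct_mulVec_comm hP.1 y x] at hsq ⊢
  rw [dotProduct_comm x v, dotProduct_comm y v] at hsq
  linarith

/-- With `φ v = ∫ t x * exp ((h + v) ⬝ x - xᵀ P x / 2) dx` this is log-concavity of the function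
`v ↦ φ v * exp (- (h + v)ᵀ P⁻¹ (h + v) / 2)` at the midpoint `0` of `v` and `-v`. Up to a linear
change of variables that function is the convolution of the log-concave `t` with a Gaussian. -/
theorem integral_mul_gaussianExp_mul_le (ht : LogConcave t) (hM : ∀ x, t x ≤ M) (hP : P.PosDef)
    (h v : Fin n → ℝ) :
    (∫ x, t x * gaussianExp P (h + v) x) * ∫ x, t x * gaussianExp P (h - v) x ≤
      Real.exp (v ⬝ᵥ (P⁻¹ *ᵥ v)) * (∫ x, t x * gaussianExp P h x) ^ 2 := by
  -- Prékopa–Leindler needs Borel functions, so `t` is replaced by its regularization.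
  set F : (Fin n → ℝ) → (Fin n → ℝ) → ℝ≥0∞ := fun w x =>
    lscReg t x * ENNReal.ofReal (gaussianExp P w x)
  have hFm : ∀ w, Measurable (F w) := fun w =>
    (measurable_lscReg t).mul (continuous_gaussianExp P w).measurable.ennreal_ofReal
  have h0 : ∀ w x, 0 ≤ t x * gaussianExp P w x := fun w x =>
    mul_nonneg (ht.1 x) (gaussianExp_pos P w x).le
  have hF : ∀ w, ∫⁻ x, F w x = ENNReal.ofReal (∫ x, t x * gaussianExp P w x) := by
    intro w
    rw [ofReal_integral_eq_lintegral_ofReal (integrable_mul_gaussianExp ht hM hP w)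
      (Eventually.of_forall (h0 w))]
    refine lintegral_congr_ae ?_
    filter_upwards [ht.ae_eq_lscReg] with x hx
    rw [ENNReal.ofReal_mul (ht.1 x), ← hx]
  set c : ℝ := Real.exp (v ⬝ᵥ (P⁻¹ *ᵥ v) / 2) with hc
  have hc2 : c ^ 2 = Real.exp (v ⬝ᵥ (P⁻¹ *ᵥ v)) := by
    rw [hc, ← Real.exp_nat_mul]
    congr 1
    push_cast
    ring
  have hc0 : 0 ≤ c := (Real.exp_pos _).le
  have hPL := lintegral_mul_lintegral_le_sq (hFm (h + v)) (hFm (h - v))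
    ((hFm h).const_mul (ENNReal.ofReal c)) fun x y => by
      have hg := ENNReal.ofReal_le_ofReal (gaussianExp_add_mul_gaussianExp_sub_le hP h v x y)
      rw [← hc2, ENNReal.ofReal_mul (gaussianExp_pos _ _ _).le, ENNReal.ofReal_mul (sq_nonneg c),
        ENNReal.ofReal_pow hc0, ENNReal.ofReal_pow (gaussianExp_pos _ _ _).le] at hg
      calc F (h + v) x * F (h - v) y = (lscReg t x * lscReg t y) *
            (ENNReal.ofReal (gaussianExp P (h + v) x) *
              ENNReal.ofReal (gaussianExp P (h - v) y)) := by simp only [F]; ring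
        _ ≤ _ := mul_le_mul' (ht.lscReg_mul_le_sq_midpoint x y) hg
        _ = _ := by simp only [F]; ring
  rw [lintegral_const_mul _ (hFm h), hF, hF, hF, ← ENNReal.ofReal_mul hc0,
    ← ENNReal.ofReal_mul (integral_nonneg (h0 _)),
    ← ENNReal.ofReal_pow (mul_nonneg hc0 (integral_nonneg (h0 _))),
    ENNReal.ofReal_le_ofReal_iff (sq_nonneg _), mul_pow, hc2] at hPL
  exact hPL

/-- The law with density proportional to `t x * exp (h ⬝ x - xᵀ P x / 2)`. -/
noncomputable def logConcaveLaw (t : (Fin n → ℝ) → ℝ) (P : Matrix (Fin n) (Fin n) ℝ)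
    (h : Fin n → ℝ) : Measure (Fin n → ℝ) :=
  volume.withDensity fun x =>
    ENNReal.ofReal (t x * gaussianExp P h x / ∫ y, t y * gaussianExp P h y)

theorem aemeasurable_logConcaveLaw_density (ht : LogConcave t) (h : Fin n → ℝ) :
    AEMeasurable fun x => t x * gaussianExp P h x / ∫ y, t y * gaussianExp P h y :=
  (ht.aemeasurable.mul (continuous_gaussianExp P h).measurable.aemeasurable).div_const _

theorem logConcaveLaw_density_nonneg (ht : LogConcave t) (h x : Fin n → ℝ) :
    0 ≤ t x * gaussianExp P h x / ∫ y, t y * gaussianExp P h y :=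
  div_nonneg (mul_nonneg (ht.1 x) (gaussianExp_pos P h x).le)
    (integral_nonneg fun y => mul_nonneg (ht.1 y) (gaussianExp_pos P h y).le)

theorem isProbabilityMeasure_logConcaveLaw (ht : LogConcave t) (hM : ∀ x, t x ≤ M)
    (hsupp : 0 < volume (tsupport t)) (hP : P.PosDef) (h : Fin n → ℝ) :
    IsProbabilityMeasure (logConcaveLaw t P h) := by
  refine ⟨?_⟩
  rw [logConcaveLaw, withDensity_apply _ MeasurableSet.univ, setLIntegral_univ,
    ← ofReal_integral_eq_lintegral_ofReal ((integrable_mul_gaussianExp ht hM hP h).div_const _)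
      (Eventually.of_forall (logConcaveLaw_density_nonneg ht h)),
    integral_div, div_self (integral_mul_gaussianExp_pos ht hM hsupp hP h).ne', ENNReal.ofReal_one]

theorem integrable_logConcaveLaw_iff (ht : LogConcave t) (h : Fin n → ℝ)
    {F : (Fin n → ℝ) → ℝ} :
    Integrable F (logConcaveLaw t P h) ↔
      Integrable fun x => t x * gaussianExp P h x / (∫ y, t y * gaussianExp P h y) * F x := by
  rw [logConcaveLaw, integrable_withDensity_iff_integrable_smul₀'
    (aemeasurable_logConcaveLaw_density ht h).ennreal_ofReal (by simp)]
  simp only [ENNReal.toReal_ofReal (logConcaveLaw_density_nonneg ht h _), smul_eq_mul]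

theorem integrable_exp_logConcaveLaw (ht : LogConcave t) (hM : ∀ x, t x ≤ M) (hP : P.PosDef)
    (h v : Fin n → ℝ) :
    Integrable (fun x => Real.exp (v ⬝ᵥ x)) (logConcaveLaw t P h) := by
  rw [integrable_logConcaveLaw_iff ht h]
  refine ((integrable_mul_gaussianExp ht hM hP (h + v)).div_const
    (∫ y, t y * gaussianExp P h y)).congr (Eventually.of_forall fun x => ?_)
  simp only [gaussianExp_add]
  ring

theorem integral_exp_logConcaveLaw (ht : LogConcave t) (h v : Fin n → ℝ) :
    ∫ x, Real.exp (v ⬝ᵥ x) ∂(logConcaveLaw t P h) =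
      (∫ x, t x * gaussianExp P (h + v) x) / ∫ x, t x * gaussianExp P h x := by
  rw [logConcaveLaw, integral_withDensity_eq_integral_toReal_smul₀
    (aemeasurable_logConcaveLaw_density ht h).ennreal_ofReal (by simp), ← integral_div]
  refine integral_congr_ae (Eventually.of_forall fun x => ?_)
  simp only [ENNReal.toReal_ofReal (logConcaveLaw_density_nonneg ht h _), smul_eq_mul,
    gaussianExp_add]
  ring

theorem memLp_coord_logConcaveLaw (ht : LogConcave t) (hM : ∀ x, t x ≤ M) (hP : P.PosDef)
    (h : Fin n → ℝ) (k : Fin n) :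
    MemLp (fun x : Fin n → ℝ => x k) 2 (logConcaveLaw t P h) := by
  refine memLp_two_of_integrable_exp (measurable_pi_apply k).aestronglyMeasurable ?_ ?_
  · simpa using integrable_exp_logConcaveLaw ht hM hP h (Pi.single k 1)
  · simpa using integrable_exp_logConcaveLaw ht hM hP h (-Pi.single k 1)

/-- Multiplying a Gaussian by a log-concave function does not increase the variance in any
direction. -/
theorem variance_dotProduct_logConcaveLaw_le (ht : LogConcave t) (hM : ∀ x, t x ≤ M)
    (hsupp : 0 < volume (tsupport t)) (hP : P.PosDef) (h v : Fin n → ℝ) :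
    Var[fun x => v ⬝ᵥ x; logConcaveLaw t P h] ≤ v ⬝ᵥ (P⁻¹ *ᵥ v) := by
  have hprob := isProbabilityMeasure_logConcaveLaw ht hM hsupp hP h
  refine le_of_forall_one_add_sq_mul_le_exp fun r => ?_
  set Z := ∫ x, t x * gaussianExp P h x
  have hZ : 0 < Z := integral_mul_gaussianExp_pos ht hM hsupp hP h
  have hneg : ∀ x : Fin n → ℝ, -((r • v) ⬝ᵥ x) = (-(r • v)) ⬝ᵥ x := fun x =>
    (neg_dotProduct _ _).symm
  have h1 := one_add_variance_le_integral_exp_mul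
    (memLp_dotProduct (memLp_coord_logConcaveLaw ht hM hP h) (r • v))
    (integrable_exp_logConcaveLaw ht hM hP h (r • v))
    (by simpa only [hneg] using integrable_exp_logConcaveLaw ht hM hP h (-(r • v)))
  simp only [hneg] at h1
  rw [integral_exp_logConcaveLaw ht, integral_exp_logConcaveLaw ht, ← sub_eq_add_neg] at h1
  have h2 := integral_mul_gaussianExp_mul_le ht hM hP h (r • v)
  have hvar : Var[fun x => (r • v) ⬝ᵥ x; logConcaveLaw t P h] =
      r ^ 2 * Var[fun x => v ⬝ᵥ x; logConcaveLaw t P h] := by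
    simp only [smul_dotProduct, smul_eq_mul]
    exact variance_const_mul _ _ _
  have hquad : (r • v) ⬝ᵥ (P⁻¹ *ᵥ (r • v)) = r ^ 2 * (v ⬝ᵥ (P⁻¹ *ᵥ v)) := by
    simp only [Matrix.mulVec_smul, dotProduct_smul, smul_dotProduct, smul_eq_mul]
    ring
  rw [hvar] at h1
  rw [hquad] at h2
  refine h1.trans ?_
  rw [div_mul_div_comm, div_le_iff₀ (mul_pos hZ hZ), ← sq]
  exact h2

theorem integrable_log_logConcaveLaw_density (ht : LogConcave t) (hM : ∀ x, t x ≤ M)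
    (hsupp : 0 < volume (tsupport t)) (hP : P.PosDef) (h : Fin n → ℝ) :
    Integrable (fun x => Real.log (t x * gaussianExp P h x / ∫ y, t y * gaussianExp P h y))
      (logConcaveLaw t P h) := by
  have hprob := isProbabilityMeasure_logConcaveLaw ht hM hsupp hP h
  have hmem := memLp_coord_logConcaveLaw ht hM hP h
  set Z := ∫ x, t x * gaussianExp P h x with hZdef
  have hZ : 0 < Z := integral_mul_gaussianExp_pos ht hM hsupp hP h
  -- `t log t` is bounded because `t` takes values in the compact interval `[0, M]`.
  obtain ⟨K, hK⟩ : ∃ K, ∀ u ∈ Icc (0 : ℝ) M, ‖u * Real.log u‖ ≤ K :=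
    isCompact_Icc.exists_bound_of_continuousOn Real.continuous_mul_log.continuousOn
  have hlogt : Integrable (fun x => Real.log (t x)) (logConcaveLaw t P h) := by
    rw [integrable_logConcaveLaw_iff ht h]
    have hb : Integrable fun x => (t x * Real.log (t x)) * gaussianExp P h x :=
      (integrable_gaussianExp hP h).bdd_mul (c := K)
        (ht.aemeasurable.mul
          (Real.measurable_log.comp_aemeasurable ht.aemeasurable)).aestronglyMeasurable
        (Eventually.of_forall fun x => hK _ ⟨ht.1 x, hM x⟩)
    refine (hb.div_const Z).congr (Eventually.of_forall fun x => ?_)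
    simp only [← hZdef]
    ring
  have hlin : Integrable (fun x => h ⬝ᵥ x) (logConcaveLaw t P h) :=
    (memLp_dotProduct hmem h).integrable one_le_two
  have hquad : Integrable (fun x => x ⬝ᵥ (P *ᵥ x)) (logConcaveLaw t P h) := by
    simpa using integrable_quadratic hmem 0 P
  have hpos : ∀ᵐ x ∂(logConcaveLaw t P h), 0 < t x := by
    rw [logConcaveLaw, ae_withDensity_iff' (aemeasurable_logConcaveLaw_density ht h).ennreal_ofReal]
    refine Eventually.of_forall fun x hx => lt_of_le_of_ne (ht.1 x) fun h0 => hx ?_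
    rw [← h0]
    simp
  refine ((hlogt.add (hlin.sub (hquad.const_mul (1 / 2)))).sub
    (integrable_const (Real.log Z))).congr ?_
  filter_upwards [hpos] with x hx
  rw [Real.log_div (mul_pos hx (gaussianExp_pos P h x)).ne' hZ.ne',
    Real.log_mul hx.ne' (gaussianExp_pos P h x).ne', gaussianExp, Real.log_exp]
  rfl

end LogConcaveGaussian

end EP

/-! ### The expectation propagation update -/

theorem EP.tilted_eq_logConcaveLaw {n : ℕ} {I : Type*} [Fintype I] [DecidableEq I]
    {t tt : I → (Fin n → ℝ) → ℝ} {i : I} {P : Matrix (Fin n) (Fin n) ℝ} {h : Fin n → ℝ} {s : ℝ}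
    (hs : 0 < s) (hc : ∀ x, EP.cavity tt i x = s * EP.gaussianExp P h x) :
    EP.tilted t tt i = EP.logConcaveLaw (t i) P h := by
  have hmul : ∀ x, t i x * EP.cavity tt i x = s * (t i x * EP.gaussianExp P h x) := fun x => by
    rw [hc]
    ring
  simp only [EP.tilted, EP.logConcaveLaw, hmul, integral_const_mul,
    mul_div_mul_left _ _ hs.ne']

theorem mainTheorem1 {n : ℕ} {I : Type*} [Fintype I] [DecidableEq I] [Nontrivial I]
    (t : I → (Fin n → ℝ) → ℝ)
    (ht : ∀ i, EP.LogConcave (t i))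
    (hbdd : ∃ M : ℝ, ∀ i x, t i x ≤ M)
    (hsupp : ∀ i, 0 < MeasureTheory.volume (tsupport (t i)))
    (tt : I → (Fin n → ℝ) → ℝ) (m : I → Fin n → ℝ) (C : I → Matrix (Fin n) (Fin n) ℝ)
    (htt : ∀ j, EP.IsGaussianFactor (tt j) (m j) (C j))
    (i : I) :
    ∃ (mc : Fin n → ℝ) (Cc : Matrix (Fin n) (Fin n) ℝ),
      EP.IsGaussianFactor (EP.cavity tt i) mc Cc ∧
      MeasureTheory.IsProbabilityMeasure (EP.tilted t tt i) ∧
      (∀ k, MeasureTheory.MemLp (fun x : Fin n → ℝ => x k) 2 (EP.tilted t tt i)) ∧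
      ∃ (mu : Fin n → ℝ) (S : Matrix (Fin n) (Fin n) ℝ),
        EP.IsGaussianKLMinimizer (EP.tilted t tt i) mu S ∧
        (∀ mu' S', EP.IsGaussianKLMinimizer (EP.tilted t tt i) mu' S' → mu' = mu ∧ S' = S) ∧
        (∀ k, mu k = ∫ x, x k ∂(EP.tilted t tt i)) ∧
        (∀ k l, S k l = ProbabilityTheory.covariance (fun x : Fin n → ℝ => x k)
          (fun x : Fin n → ℝ => x l) (EP.tilted t tt i)) ∧
        (S⁻¹ - Cc⁻¹).PosSemidef ∧
        ∃ (h : Fin n → ℝ) (s : ℝ), 0 < s ∧ ∀ x, EP.updatedFactor tt i mu S x =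
          s * Real.exp (h ⬝ᵥ x - 1 / 2 * (x ⬝ᵥ ((S⁻¹ - Cc⁻¹) *ᵥ x))) := by
  obtain ⟨M, hM⟩ := hbdd
  obtain ⟨j, hj⟩ := exists_ne i
  obtain ⟨P, h, s, hP, hs, hc⟩ := EP.exists_prod_eq_gaussianExp htt
    (J := Finset.univ.erase i) ⟨j, by simp [hj]⟩
  change ∀ x, EP.cavity tt i x = s * EP.gaussianExp P h x at hc
  have hPP : P⁻¹⁻¹ = P := Matrix.nonsing_inv_nonsing_inv _ (EP.posDef_isUnit_det hP)
  rw [EP.tilted_eq_logConcaveLaw (t := t) hs hc]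
  set Q := EP.logConcaveLaw (t i) P h
  have hprob : IsProbabilityMeasure Q :=
    EP.isProbabilityMeasure_logConcaveLaw (ht i) (hM i) (hsupp i) hP h
  have hmem := EP.memLp_coord_logConcaveLaw (ht i) (hM i) hP h
  obtain ⟨hmin, huniq⟩ := EP.isGaussianKLMinimizer_meanVec_covMatrix (Q := Q)
    (EP.aemeasurable_logConcaveLaw_density (ht i) h) rfl hmem
    (EP.integrable_log_logConcaveLaw_density (ht i) (hM i) (hsupp i) hP h)
  have hS : (EP.covMatrix Q).PosDef := hmin.1
  refine ⟨P⁻¹ *ᵥ h, P⁻¹, ⟨hP.inv, ?_⟩, hprob, hmem, EP.meanVec Q, EP.covMatrix Q, hmin, huniq,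
    fun k => rfl, fun k l => rfl, ?_, ?_⟩
  · obtain ⟨s', hs', hx⟩ := EP.gaussianExp_eq_mul_gaussianDensity hP h
    exact ⟨s * s', mul_pos hs hs', fun x => by rw [hc, hx, mul_assoc]⟩
  · refine EP.posSemidef_inv_sub_inv hS hP.inv fun v => ?_
    rw [EP.dotProduct_covMatrix_mulVec hmem]
    exact EP.variance_dotProduct_logConcaveLaw_le (ht i) (hM i) (hsupp i) hP h v
  · obtain ⟨s', hs', hx⟩ := EP.gaussianDensity_eq_mul_gaussianExp (EP.meanVec Q) hS
    refine ⟨(EP.covMatrix Q)⁻¹ *ᵥ EP.meanVec Q - h, s' / s, div_pos hs' hs, fun x => ?_⟩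
    rw [EP.updatedFactor, hc, hx, mul_div_mul_comm, EP.gaussianExp, EP.gaussianExp,
      ← Real.exp_sub, hPP, sub_dotProduct, Matrix.sub_mulVec, dotProduct_sub]
    congr 2
    ring
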